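/- Let $\mathcal{A}$ be a countable set with the discrete $\sigma$-algebra. For a finite $H\subset\mathbb{Z}$ and $x\in\mathcal{A}^{\mathbb{Z}}$ write $x_H=(x_i)_{i\in H}$. Fix finite sets $D,G\subset\mathbb{Z}$. For $n\ge 1$, $x_1^n\in\mathcal{A}^n$, $b\in\mathcal{A}^D$ and $a\in\mathcal{A}^G$, let $N^n_{D,G}[x_1^n](b,a)$ be the number of $i\in\{0,\dots,n-1\}$ with $D+i\subset\{1,\dots,n\}$, $G+i\subset\{1,\dots,n\}$, $x_{D+i}=b$ and $x_{G+i}=a$. Let $\hat f^n_{D,G}[x_1^n](b)\in\mathcal{A}^G$ be any maximizer of $a\mapsto N^n_{D,G}[x_1^n](b,a)/n$ (ties are broken arbitrarily). For a probability measure $\mathbb{P}$ on $\mathcal{A}^{\mathbb{Z}}$, with $X$ and $Y$ independent of law $\mathbb{P}$ and $\widetilde{\mathbb{P}}=\mathbb{P}\otimes\mathbb{P}$, the excess risk of $\hat f^n_{D,G}$ under $\mathbb{P}$ is $$R(\hat f^n_{D,G})=\sup_{b\in\mathcal{A}^D}\Big(\widetilde{\mathbb{P}}\big(\hat f^n_{D,G}[X_1^n](Y_D)\ne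 Y_G\mid Y_D=b\big)-\inf_{a\in\mathcal{A}^G}\widetilde{\mathbb{P}}\big(a\ne Y_G\mid Y_D=b\big)\Big)\,\widetilde{\mathbb{P}}(Y_D=b),$$ where the term of $b$ is $0$ if $\widetilde{\mathbb{P}}(Y_D=b)=0$. The margin of $\mathbb{P}$ is $\delta_{D,G}=\inf_{b\in\mathcal{A}^D}\delta_{D,G}(b)$, where $\delta_{D,G}(b)$ is the infimum of the strictly positive numbers among $\mathbb{P}(X_G\ne c,X_D=b)-\inf_{a\in\mathcal{A}^G}\mathbb{P}(X_G\ne a,X_D=b)$, $c\in\mathcal{A}^G$, and $\delta_{D,G}(b)=0$ if there are none. Further, $$\beta_{D,G}=\sup_{b\in\mathcal{A}^D}\Big\{\sup_{a\in\mathcal{A}^G}\mathbb{P}(Y_G=a,Y_D=b)-\inf_{c\in\mathcal{A}^G}\mathbb{P}(Y_G=c,Y_D=b)\Big\}.$$ Let $\mathbb{Z}_-=\{-1,-2,\dots\}$ and let $p(a|x)$, $a\in\mathcal{A}$, $x\in\mathcal{A}^{\mathbb{Z}_-}$, be a probability kernel that is a regular version of the left conditional probabilities of $\mathbb{P}$,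 that is, $\mathbb{P}(X_0=a\mid\sigma(X_i,i<0))=p(a|X_{\mathbb{Z}_-})$ $\mathbb{P}$-a.s. for every $a\in\mathcal A$. For $j\ge0$ put $$\mathrm{Var}_j(p)=\sup\Big\{\tfrac12\sum_{a\in\mathcal{A}}|p(a|x)-p(a|y)|:\ x,y\in\mathcal{A}^{\mathbb{Z}_-},\ x_i=y_i\text{ for }-j\le i\le-1\Big\},\qquad \Gamma(\mathbb{P})=\prod_{j=0}^\infty(1-\mathrm{Var}_j(p)).$$ Let $(\mathbb{P}_n)_{n\ge1}$ be shift-invariant probability measures on $\mathcal{A}^{\mathbb{Z}}$, with chosen regular versions $p_n$ of their left conditional probabilities, such that $\Gamma(\mathbb{P}_n)\ge\Gamma>0$ for all $n\ge2$. Let $\delta_n$ be the margin of $\mathbb{P}_n$; below, $R(\hat f^n_{D,G})$ and $\beta_{D,G}$ are taken with respect to $\mathbb{P}_n$. (1) If $\delta_n\sqrt{n/\log n}\to0$, then there is $n_0\ge2$ such that for all $n\ge n_0$, $$R(\hat f^n_{D,G})\le\tfrac12\sqrt{\frac{\log n}{n}}\wedge\beta_{D,G}.$$ (2) If $\delta_n\sqrt{n/\log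 n}\to\infty$, then there is $n_0'\ge1$ such that for all $n\ge n_0'$, $$R(\hat f^n_{D,G})\le\exp\Big(-\frac{\Gamma^2\,n\,\delta_n^2}{8(|G|+|D|)^2}\Big)\wedge\beta_{D,G}$$ (the exponent being read as $0$ if $D=G=\emptyset$). -/

import Mathlib

open MeasureTheory ProbabilityTheory Filter Topology

namespace Guessing

variable {A : Type*}

/-- The restriction `x_H` of a bi-infinite sequence to a finite set `H` of integers. -/
def restr (H : Finset ℤ) (x : ℤ → A) : H → A := fun i => x i

/-- The sample `x_1, …, x_n` of a bi-infinite sequence. -/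
noncomputable def sample (n : ℕ) (x : ℤ → A) : Finset.Icc (1 : ℤ) n → A := restr (Finset.Icc (1 : ℤ) n) x

/-- The past `(x_i)_{i < 0}` of a bi-infinite sequence. -/
def past (x : ℤ → A) : Set.Iio (0 : ℤ) → A := fun i => x i

open scoped Classical in
/-- The number of `i ∈ {0, …, n-1}` such that `D + i` and `G + i` are contained in `{1, …, n}`
and the sample `x` reads `b` on `D + i` and `a` on `G + i`. -/
noncomputable def count (n : ℕ) (D G : Finset ℤ) (x : Finset.Icc (1 : ℤ) n → A)
    (b : D → A) (a : G → A) : ℕ :=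
  ((Finset.range n).filter fun i : ℕ =>
    (∀ j : D, ∃ h : (j : ℤ) + i ∈ Finset.Icc (1 : ℤ) n, x ⟨(j : ℤ) + i, h⟩ = b j) ∧
    (∀ j : G, ∃ h : (j : ℤ) + i ∈ Finset.Icc (1 : ℤ) n, x ⟨(j : ℤ) + i, h⟩ = a j)).card

/-- `f` is a version of the estimator: `f x b` is a maximizer of `a ↦ N(b, a) / n`
(ties may be broken in any way). -/
def IsArgmaxEstimator (n : ℕ) (D G : Finset ℤ)
    (f : (Finset.Icc (1 : ℤ) n → A) → (D → A) → (G → A)) : Prop :=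
  ∀ (x : Finset.Icc (1 : ℤ) n → A) (b : D → A) (a : G → A),
    (count n D G x b a : ℝ) / n ≤ (count n D G x b (f x b) : ℝ) / n

variable [MeasurableSpace A]

/-- The law `P` on `A^ℤ` is stationary, that is, invariant under all shifts. -/
def IsStationary (P : Measure (ℤ → A)) : Prop :=
  ∀ k : ℤ, P.map (fun x i => x (i + k)) = P

/-- The probability kernel `p` is a regular version of the left conditional probabilities
of `P`: for each symbol `a`, almost surely `P(X_0 = a | σ(X_i, i < 0)) = p(a | past)`. -/
def IsLeftConditional (P : Measure (ℤ → A)) (p : Kernel (Set.Iio (0 : ℤ) → A) A) : Prop :=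
  ∀ a : A,
    P[Set.indicator {x : ℤ → A | x 0 = a} (fun _ => (1 : ℝ)) |
        MeasurableSpace.comap past inferInstance]
      =ᵐ[P] fun x => (p (past x)).real {a}

/-- The variation `Var_n(p)`. -/
noncomputable def variation (p : Kernel (Set.Iio (0 : ℤ) → A) A) (n : ℕ) : ℝ :=
  sSup {r : ℝ | ∃ x y : Set.Iio (0 : ℤ) → A,
    (∀ i : Set.Iio (0 : ℤ), -(n : ℤ) ≤ i → x i = y i) ∧
    r = 1 / 2 * ∑' a : A, |(p x).real {a} - (p y).real {a}|}

/-- `Γ = ∏_{j ≥ 0} (1 - Var_j(p))`. -/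
noncomputable def Gam (p : Kernel (Set.Iio (0 : ℤ) → A) A) : ℝ :=
  ∏' j : ℕ, (1 - variation p j)

/-- The margin `δ(b)` at `b`; it is `0` when the set is empty. -/
noncomputable def marginAt (P : Measure (ℤ → A)) (D G : Finset ℤ) (b : D → A) : ℝ :=
  sInf {r : ℝ | 0 < r ∧ ∃ c : G → A,
    r = P.real {x | restr G x ≠ c ∧ restr D x = b}
      - ⨅ a : G → A, P.real {x | restr G x ≠ a ∧ restr D x = b}}

/-- The margin `δ_{D,G}`. -/
noncomputable def margin (P : Measure (ℤ → A)) (D G : Finset ℤ) : ℝ :=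
  ⨅ b : D → A, marginAt P D G b

/-- The quantity `β_{D,G}`. -/
noncomputable def beta (P : Measure (ℤ → A)) (D G : Finset ℤ) : ℝ :=
  ⨆ b : D → A,
    ((⨆ a : G → A, P.real {y | restr G y = a ∧ restr D y = b})
      - ⨅ c : G → A, P.real {y | restr G y = c ∧ restr D y = b})

/-- The excess risk of an estimator `f` under `P ⊗ P`; the first coordinate of `ω` is the
process `X` from which the sample is taken, the second one is the independent copy `Y`.
Data `b` of probability zero contribute `0`. -/
noncomputable def risk (P : Measure (ℤ → A)) (n : ℕ) (D G : Finset ℤ)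
    (f : (Finset.Icc (1 : ℤ) n → A) → (D → A) → (G → A)) : ℝ :=
  ⨆ b : D → A,
    (((P.prod P)[|{ω | restr D ω.2 = b}]).real
          {ω | f (sample n ω.1) (restr D ω.2) ≠ restr G ω.2}
      - ⨅ a : G → A,
          ((P.prod P)[|{ω | restr D ω.2 = b}]).real {ω | a ≠ restr G ω.2})
    * (P.prod P).real {ω | restr D ω.2 = b}

end Guessing

namespace Guessing

/-! ### Hoeffding's lemma, comparison in total variation, infinite products. -/

section General

/-! Write L = |G| + |D|, m for the number of windows that fit in the sample, and q(b, a) for the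
probability of reading b on D and a on G. Since Y is independent of the sample, the contribution of
b to the risk is the mean of the gap sup_a q(b, a) - q(b, f(b)), where f(b) is the prediction. As
f(b) maximizes the counts, m times the gap is at most 2Z, with Z the largest deviation, over a, of a
count from its mean m q(b, a). It remains to control the fluctuations and the mean of Z, uniformly
in b.

Fluctuations (`hasSubgaussianMGF_sample`): let a function of the sample change by at most c per
changed symbol. Couple two copies of the chain of pasts maximally at each step. By the recursion
`futureDiscrepancy_step`, one discrepancy, together with those it causes later, costs at most 1/Γ in
the mean. Averaging out the symbols one at a time, newest first, thus costs one Hoeffding factor of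
oscillation c/Γ per step. For Z one has c = L.

Mean (`integral_maxDeviation_le`): the alphabet may be infinite, so a union bound over a is not
available. Instead, Z² is at most the sum of the squared deviations. With suitable signs, the mean
of this sum is at most the second moment of a signed sum of deviations. Each window reads at most
one a, so the signed sum changes by at most 2L per symbol however many a enter, and concentration
bounds its second moment. Hence E Z = O(√n).

So the risk is O(1/√n), which the factor √(log n) eventually absorbs. If the margin δ is large, use
that the gap is at most 1 and is either 0 or at least δ: its mean is at most P(Z ≥ mδ/2), and mδ/2
exceeds E Z by at least (n + 1)δ/4. The bound by β holds pointwise in the sample. -/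

theorem integrable_of_abs_le {Ω : Type*} [MeasurableSpace Ω] {μ : Measure Ω} [IsFiniteMeasure μ]
    {F : Ω → ℝ} {C : ℝ} (hF : Measurable F) (hC : ∀ x, |F x| ≤ C) : Integrable F μ :=
  Integrable.of_bound hF.aestronglyMeasurable C (ae_of_all _ hC)

theorem integrable_exp_of_abs_le {Ω : Type*} [MeasurableSpace Ω] {μ : Measure Ω}
    [IsFiniteMeasure μ] {F : Ω → ℝ} {C : ℝ} (hF : Measurable F) (hC : ∀ x, |F x| ≤ C) (l : ℝ) :
    Integrable (fun x => Real.exp (l * F x)) μ := by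
  refine integrable_of_abs_le (C := Real.exp (|l| * C))
    (Real.measurable_exp.comp (hF.const_mul l)) fun x => ?_
  rw [abs_of_pos (Real.exp_pos _)]
  refine Real.exp_le_exp.2 ((le_abs_self _).trans ?_)
  rw [abs_mul]
  exact mul_le_mul_of_nonneg_left (hC x) (abs_nonneg _)

/-- **Hoeffding's lemma** for a bounded function of oscillation at most `K`. -/
theorem integral_exp_le_of_oscillation {Ω : Type*} [MeasurableSpace Ω] {μ : Measure Ω}
    [IsProbabilityMeasure μ] {F : Ω → ℝ} {C K : ℝ} (hF : Measurable F) (hC : ∀ x, |F x| ≤ C)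
    (hK : ∀ x y, F x - F y ≤ K) (l : ℝ) :
    ∫ x, Real.exp (l * F x) ∂μ ≤ Real.exp (l * ∫ x, F x ∂μ + l ^ 2 * K ^ 2 / 8) := by
  have hne : Nonempty Ω := μ.nonempty_of_neZero
  have hb : BddBelow (Set.range F) := ⟨-C, by
    rintro _ ⟨x, rfl⟩
    exact neg_le_of_abs_le (hC x)⟩
  have hmem : ∀ x, F x ∈ Set.Icc (⨅ y, F y) ((⨅ y, F y) + K) := fun x =>
    ⟨ciInf_le hb x, by
      have : F x - K ≤ ⨅ y, F y := le_ciInf fun y => by linarith [hK x y]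
      linarith⟩
  have h := (hasSubgaussianMGF_of_mem_Icc (μ := μ) hF.aemeasurable (ae_of_all _ hmem)).mgf_le l
  have hsplit : mgf (fun x => F x - ∫ y, F y ∂μ) μ l
      = Real.exp (-(l * ∫ x, F x ∂μ)) * ∫ x, Real.exp (l * F x) ∂μ := by
    rw [mgf, ← integral_const_mul]
    refine integral_congr_ae (ae_of_all _ fun x => ?_)
    simp only [← Real.exp_add]
    ring_nf
  rw [hsplit] at h
  have hc : (((‖((⨅ y, F y) + K) - (⨅ y, F y)‖₊ / 2) ^ 2 : NNReal) : ℝ) = K ^ 2 / 4 := by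
    push_cast
    rw [add_sub_cancel_left, Real.norm_eq_abs, div_pow, sq_abs]
    norm_num
  rw [hc] at h
  calc ∫ x, Real.exp (l * F x) ∂μ
      = Real.exp (l * ∫ x, F x ∂μ) *
          (Real.exp (-(l * ∫ x, F x ∂μ)) * ∫ x, Real.exp (l * F x) ∂μ) := by
        rw [← mul_assoc, ← Real.exp_add]; simp
    _ ≤ Real.exp (l * ∫ x, F x ∂μ) * Real.exp (K ^ 2 / 4 * l ^ 2 / 2) :=
        mul_le_mul_of_nonneg_left h (Real.exp_pos _).le
    _ = _ := by rw [← Real.exp_add]; ring_nf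

variable {A : Type*} [Countable A] [MeasurableSpace A] [DiscreteMeasurableSpace A]

theorem tsum_measure_singleton (μ : Measure A) : ∑' a, μ {a} = μ Set.univ := by
  rw [← lintegral_one, lintegral_countable']
  simp

theorem summable_real_singleton (μ : Measure A) [IsFiniteMeasure μ] :
    Summable fun a => μ.real {a} :=
  ENNReal.summable_toReal (by rw [tsum_measure_singleton]; exact measure_ne_top _ _)

theorem tsum_real_singleton (μ : Measure A) [IsProbabilityMeasure μ] :
    ∑' a, μ.real {a} = 1 := by
  have h := tsum_measure_singleton μ
  simp only [measure_univ] at h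
  simp only [measureReal_def]
  rw [← ENNReal.tsum_toReal_eq (fun a => measure_ne_top _ _), h, ENNReal.toReal_one]

/-- The expectations of `f` and `g` under two laws at total variation distance at most `v` are
compared by means of a maximal coupling of these laws. -/
theorem integral_sub_integral_le_of_tv {μ ν : Measure A} [IsProbabilityMeasure μ]
    [IsProbabilityMeasure ν] {f g : A → ℝ} {C α β v : ℝ} (hf : ∀ a, |f a| ≤ C)
    (hg : ∀ a, |g a| ≤ C) (hαβ : α ≤ β) (hα : ∀ a, f a - g a ≤ α) (hβ : ∀ a b, f a - g b ≤ β)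
    (hv : 1 / 2 * ∑' a, |μ.real {a} - ν.real {a}| ≤ v) :
    ∫ a, f a ∂μ - ∫ a, g a ∂ν ≤ (1 - v) * α + v * β := by
  have hne : Nonempty A := μ.nonempty_of_neZero
  have hfi : Integrable f μ := integrable_of_abs_le (measurable_of_countable f) hf
  have hgi : Integrable g ν := integrable_of_abs_le (measurable_of_countable g) hg
  rw [integral_countable hfi, integral_countable hgi]
  simp only [smul_eq_mul]
  have hbb : BddBelow (Set.range g) := ⟨-C, by
    rintro _ ⟨x, rfl⟩
    exact neg_le_of_abs_le (hg x)⟩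
  set θ := ⨅ a, g a
  have hθg : ∀ a, θ ≤ g a := fun a => ciInf_le hbb a
  have hfθ : ∀ a, f a ≤ θ + β := fun a => by
    have : f a - β ≤ θ := le_ciInf fun b => by linarith [hβ a b]
    linarith
  have hsμ := summable_real_singleton μ
  have hsν := summable_real_singleton ν
  have hbound : ∀ {w h : A → ℝ}, Summable w → (∀ a, 0 ≤ w a) → (∀ a, |h a| ≤ C) →
      Summable fun a => w a * h a := fun {w h} hw hw0 hh =>
    Summable.of_norm_bounded (hw.mul_right C) fun a => by
      rw [norm_mul, Real.norm_eq_abs, Real.norm_eq_abs, abs_of_nonneg (hw0 a)]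
      exact mul_le_mul_of_nonneg_left (hh a) (hw0 a)
  have hμf := hbound hsμ (fun _ => measureReal_nonneg) hf
  have hνg := hbound hsν (fun _ => measureReal_nonneg) hg
  have habs : Summable fun a => |μ.real {a} - ν.real {a}| := (hsμ.sub hsν).abs
  set τ := 1 / 2 * ∑' a, |μ.real {a} - ν.real {a}| with hτ
  -- The three weights are min(μ, ν), (μ - ν)⁺ and (μ - ν)⁻. On the common mass f - g ≤ α; on the
  -- excesses f ≤ θ + β and g ≥ θ. The masses sum to 1 - τ, τ and τ, so θ cancels.
  have hterm : ∀ a, μ.real {a} * f a - ν.real {a} * g a ≤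
      1 / 2 * (μ.real {a} + ν.real {a} - |μ.real {a} - ν.real {a}|) * α
      + 1 / 2 * (|μ.real {a} - ν.real {a}| + (μ.real {a} - ν.real {a})) * (θ + β)
      - 1 / 2 * (|μ.real {a} - ν.real {a}| - (μ.real {a} - ν.real {a})) * θ := fun a => by
    have hx : 0 ≤ μ.real {a} := measureReal_nonneg
    have hy : 0 ≤ ν.real {a} := measureReal_nonneg
    generalize μ.real {a} = x at *
    generalize ν.real {a} = y at *
    rcases le_total x y with h | h
    · rw [abs_of_nonpos (sub_nonpos.2 h)]
      nlinarith [mul_le_mul_of_nonneg_left (hα a) hx,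
        mul_le_mul_of_nonneg_left (hθg a) (sub_nonneg.2 h)]
    · rw [abs_of_nonneg (sub_nonneg.2 h)]
      nlinarith [mul_le_mul_of_nonneg_left (hα a) hy,
        mul_le_mul_of_nonneg_left (hfθ a) (sub_nonneg.2 h)]
  have hR : HasSum (fun a =>
      1 / 2 * (μ.real {a} + ν.real {a} - |μ.real {a} - ν.real {a}|) * α
      + 1 / 2 * (|μ.real {a} - ν.real {a}| + (μ.real {a} - ν.real {a})) * (θ + β)
      - 1 / 2 * (|μ.real {a} - ν.real {a}| - (μ.real {a} - ν.real {a})) * θ)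
      (1 / 2 * (1 + 1 - 2 * τ) * α + 1 / 2 * (2 * τ + (1 - 1)) * (θ + β)
        - 1 / 2 * (2 * τ - (1 - 1)) * θ) := by
    have e1 : HasSum (fun a => μ.real {a}) 1 := tsum_real_singleton μ ▸ hsμ.hasSum
    have e2 : HasSum (fun a => ν.real {a}) 1 := tsum_real_singleton ν ▸ hsν.hasSum
    have e3 : HasSum (fun a => |μ.real {a} - ν.real {a}|) (2 * τ) := by
      have h := habs.hasSum
      rwa [show ∑' a, |μ.real {a} - ν.real {a}| = 2 * τ by rw [hτ]; ring] at h
    exact (((((e1.add e2).sub e3).mul_left _).mul_right _).add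
      (((e3.add (e1.sub e2)).mul_left _).mul_right _)).sub
      (((e3.sub (e1.sub e2)).mul_left _).mul_right _)
  have h := hasSum_le hterm (hμf.hasSum.sub hνg.hasSum) hR
  nlinarith [mul_le_mul_of_nonneg_right hv (sub_nonneg.2 hαβ)]

/-- Infinite products of factors in `[0, 1]` are dominated by their partial products. -/
theorem tprod_le_prod_range_of_mem_Icc {u : ℕ → ℝ} (h0 : ∀ i, 0 ≤ u i) (h1 : ∀ i, u i ≤ 1)
    (k : ℕ) : ∏' i, u i ≤ ∏ i ∈ Finset.range k, u i := by
  have hanti : Antitone fun s : Finset ℕ => ∏ i ∈ s, u i := fun s t hst =>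
    Finset.prod_le_prod_of_subset_of_le_one hst (fun i _ => h0 i) (fun i _ _ => h1 i)
  have hbdd : BddBelow (Set.range fun s : Finset ℕ => ∏ i ∈ s, u i) := ⟨0, by
    rintro _ ⟨s, rfl⟩
    exact Finset.prod_nonneg fun i _ => h0 i⟩
  -- The finite products decrease and are bounded below, so the product converges unconditionally
  -- and `tprod` is not the default value 1.
  have hprod : HasProd u (⨅ s : Finset ℕ, ∏ i ∈ s, u i) := by
    rw [HasProd, SummationFilter.unconditional_filter]
    exact tendsto_atTop_ciInf hanti hbdd
  rw [hprod.tprod_eq]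
  exact ciInf_le hbdd _

end General
end Guessing

namespace Guessing

/-! ### The Markov chain of pasts and its invariant law. -/

section Chain

variable {A : Type*}

/-- The past obtained from the past `x` when the symbol `a` is observed. -/
def append (x : Set.Iio (0 : ℤ) → A) (a : A) : Set.Iio (0 : ℤ) → A := fun i =>
  if h : (i : ℤ) + 1 < 0 then x ⟨(i : ℤ) + 1, h⟩ else a

/-- The symbol at time `-(i + 1)` of a past. -/
def back (x : Set.Iio (0 : ℤ) → A) (i : ℕ) : A := x ⟨-(i + 1 : ℤ), by simp; omega⟩

theorem back_append_zero (x : Set.Iio (0 : ℤ) → A) (a : A) : back (append x a) 0 = a := by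
  simp [back, append]

theorem back_append_succ (x : Set.Iio (0 : ℤ) → A) (a : A) (i : ℕ) :
    back (append x a) (i + 1) = back x i := by
  have h : -((i + 1 : ℕ) + 1 : ℤ) + 1 < 0 := by push_cast; omega
  simp only [back, append]
  rw [dif_pos h]
  congr 2

/-- Two pasts agree on the last `j` symbols. -/
def Agree (j : ℕ) (x y : Set.Iio (0 : ℤ) → A) : Prop :=
  ∀ i : Set.Iio (0 : ℤ), -(j : ℤ) ≤ i → x i = y i

theorem Agree.append {j : ℕ} {x y : Set.Iio (0 : ℤ) → A} (h : Agree j x y) (a : A) :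
    Agree (j + 1) (append x a) (append y a) := fun i hi => by
  simp only [Guessing.append]
  split_ifs with h1
  · exact h _ (by simp only; push_cast at hi; linarith)
  · rfl

theorem agree_zero (x y : Set.Iio (0 : ℤ) → A) : Agree 0 x y := fun i hi => by
  have h1 : (i : ℤ) < 0 := i.2
  simp at hi
  omega

open scoped Classical in
/-- The number of discrepancies between the last `k` symbols of two pasts. -/
noncomputable def discrepancy (k : ℕ) (x y : Set.Iio (0 : ℤ) → A) : ℝ :=
  ∑ i ∈ Finset.range k, if back x i = back y i then 0 else 1

theorem discrepancy_self (k : ℕ) (x : Set.Iio (0 : ℤ) → A) : discrepancy k x x = 0 := by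
  simp [discrepancy]

open scoped Classical in
theorem discrepancy_append (k : ℕ) (x y : Set.Iio (0 : ℤ) → A) (a b : A) :
    discrepancy (k + 1) (append x a) (append y b)
      = discrepancy k x y + if a = b then 0 else 1 := by
  simp only [discrepancy, Finset.sum_range_succ', back_append_succ, back_append_zero]

variable [MeasurableSpace A]

theorem measurable_past : Measurable (past : (ℤ → A) → _) :=
  measurable_pi_lambda _ fun _ => measurable_pi_apply _

theorem measurable_append : Measurable fun z : (Set.Iio (0 : ℤ) → A) × A => append z.1 z.2 := by
  refine measurable_pi_lambda _ fun i => ?_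
  simp only [append]
  split_ifs with h
  · exact (measurable_pi_apply _).comp measurable_fst
  · exact measurable_snd

/-- The transition operator of the chain of pasts. -/
noncomputable def transition (p : Kernel (Set.Iio (0 : ℤ) → A) A)
    (F : (Set.Iio (0 : ℤ) → A) → ℝ) (x : Set.Iio (0 : ℤ) → A) : ℝ :=
  ∫ a, F (append x a) ∂(p x)

theorem measurable_transition (p : Kernel (Set.Iio (0 : ℤ) → A) A) [IsMarkovKernel p]
    {F : (Set.Iio (0 : ℤ) → A) → ℝ} (hF : Measurable F) : Measurable (transition p F) := by
  have h : StronglyMeasurable fun z : (Set.Iio (0 : ℤ) → A) × A => F (append z.1 z.2) :=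
    (hF.comp measurable_append).stronglyMeasurable
  exact h.integral_kernel_prod_right'.measurable

theorem abs_transition_le (p : Kernel (Set.Iio (0 : ℤ) → A) A) [IsMarkovKernel p]
    {F : (Set.Iio (0 : ℤ) → A) → ℝ} {C : ℝ} (hC : ∀ x, |F x| ≤ C) (x : Set.Iio (0 : ℤ) → A) :
    |transition p F x| ≤ C := by
  have h := norm_integral_le_of_norm_le_const (μ := p x) (f := fun a => F (append x a)) (C := C)
    (ae_of_all _ fun a => hC _)
  simpa [transition] using h

variable [Countable A] [DiscreteMeasurableSpace A]

/-- The conditional probabilities are given symbol by symbol, which settles the sets t × {a}. Since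
the alphabet is countable, every measurable set is a countable disjoint union of such sets. -/
theorem map_past_eval_eq_compProd {P : Measure (ℤ → A)} [IsProbabilityMeasure P]
    {p : Kernel (Set.Iio (0 : ℤ) → A) A} [IsMarkovKernel p] (hp : IsLeftConditional P p) :
    P.map (fun x => (past x, x 0)) = (P.map past) ⊗ₘ p := by
  have hpast : Measurable (past : (ℤ → A) → _) := measurable_past
  have hpair : Measurable fun x : ℤ → A => (past x, x 0) :=
    hpast.prodMk (measurable_pi_apply 0)
  have hrect : ∀ (t : Set (Set.Iio (0 : ℤ) → A)) (a : A), MeasurableSet t →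
      (P.map fun x => (past x, x 0)) (t ×ˢ {a}) = ((P.map past) ⊗ₘ p) (t ×ˢ {a}) := by
    intro t a ht
    have hm : MeasurableSpace.comap past inferInstance ≤ (inferInstance : MeasurableSpace (ℤ → A)) :=
      hpast.comap_le
    have hset : MeasurableSet {x : ℤ → A | x 0 = a} :=
      (measurable_pi_apply (0 : ℤ) : Measurable fun x : ℤ → A => x 0) (measurableSet_singleton a)
    have hint : Integrable (Set.indicator {x : ℤ → A | x 0 = a} fun _ => (1 : ℝ)) P :=
      (integrable_const 1).indicator hset
    have h1 := setIntegral_condExp hm hint (s := past ⁻¹' t) ⟨t, ht, rfl⟩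
    rw [setIntegral_congr_ae (hpast ht) ((hp a).mono fun x hx _ => hx),
      integral_indicator_const _ hset, smul_eq_mul, mul_one] at h1
    have hreal : Integrable (fun x => (p (past x)).real {a}) (P.restrict (past ⁻¹' t)) :=
      integrable_of_abs_le (C := 1)
        ((p.measurable_coe (measurableSet_singleton a)).ennreal_toReal.comp hpast)
        fun x => by rw [abs_of_nonneg measureReal_nonneg]; exact measureReal_le_one
    rw [Measure.map_apply hpair (ht.prod (measurableSet_singleton a)),
      Measure.compProd_apply_prod ht (measurableSet_singleton a),
      setLIntegral_map ht (p.measurable_coe (measurableSet_singleton a)) hpast]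
    have h2 := ofReal_integral_eq_lintegral_ofReal hreal (ae_of_all _ fun x => measureReal_nonneg)
    rw [h1] at h2
    simp only [measureReal_def, ENNReal.ofReal_toReal (measure_ne_top _ _)] at h2
    rw [← h2, Measure.restrict_apply hset, Set.inter_comm]
    rfl
  ext W hW
  have hslice : ∀ a : A, MeasurableSet {x | (x, a) ∈ W} := fun a =>
    (measurable_id.prodMk measurable_const) hW
  have hdec : W = ⋃ a : A, {x | (x, a) ∈ W} ×ˢ {a} := by
    ext ⟨x, a⟩
    simp
  have hdisj : Pairwise (Function.onFun Disjoint fun a : A =>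
      ({x | (x, a) ∈ W} ×ˢ {a} : Set ((Set.Iio (0 : ℤ) → A) × A))) := by
    intro a b hab
    refine Set.disjoint_left.2 ?_
    rintro ⟨x, c⟩ ⟨_, h1⟩ ⟨_, h2⟩
    exact hab (h1.symm.trans h2)
  rw [hdec, measure_iUnion hdisj fun a => (hslice a).prod (measurableSet_singleton a),
    measure_iUnion hdisj fun a => (hslice a).prod (measurableSet_singleton a)]
  exact tsum_congr fun a => hrect _ a (hslice a)

/-- Appending X_0 to the past of X gives the past of the shifted sequence, which has the same law by
stationarity. -/
theorem integral_transition {P : Measure (ℤ → A)} [IsProbabilityMeasure P]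
    (hP : IsStationary P) {p : Kernel (Set.Iio (0 : ℤ) → A) A} [IsMarkovKernel p]
    (hp : IsLeftConditional P p) {F : (Set.Iio (0 : ℤ) → A) → ℝ} {C : ℝ} (hF : Measurable F)
    (hC : ∀ x, |F x| ≤ C) :
    ∫ x, transition p F x ∂(P.map past) = ∫ x, F x ∂(P.map past) := by
  have hpast : Measurable (past : (ℤ → A) → _) := measurable_past
  have hpair : Measurable fun x : ℤ → A => (past x, x 0) :=
    hpast.prodMk (measurable_pi_apply 0)
  have : IsProbabilityMeasure (P.map (past : (ℤ → A) → _)) :=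
    Measure.isProbabilityMeasure_map hpast.aemeasurable
  have hshift : Measurable fun (x : ℤ → A) (i : ℤ) => x (i + 1) :=
    measurable_pi_lambda _ fun _ => measurable_pi_apply _
  have hG : Measurable fun z : (Set.Iio (0 : ℤ) → A) × A => F (append z.1 z.2) :=
    hF.comp measurable_append
  have h := Measure.integral_compProd (μ := P.map past) (κ := p)
    (f := fun z => F (append z.1 z.2)) (integrable_of_abs_le hG fun z => hC _)
  simp only [transition]
  rw [← h, ← map_past_eval_eq_compProd hp, integral_map hpair.aemeasurable
    hG.aestronglyMeasurable]
  conv_rhs => rw [← hP 1]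
  rw [Measure.map_map hpast hshift,
    integral_map (hpast.comp hshift).aemeasurable hF.aestronglyMeasurable]
  refine integral_congr_ae (ae_of_all _ fun x => ?_)
  simp only
  congr 1
  funext i
  simp only [append, past, Function.comp]
  split_ifs with h1
  · rfl
  · have h2 : (i : ℤ) < 0 := i.2
    congr 1
    omega

end Chain
end Guessing

namespace Guessing

/-! ### Concentration for functions of the sample, by coupling pasts. -/

section Concentration

variable {A : Type*} [MeasurableSpace A]

theorem variation_nonneg (p : Kernel (Set.Iio (0 : ℤ) → A) A) (j : ℕ) : 0 ≤ variation p j :=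
  Real.sSup_nonneg (by rintro _ ⟨x, y, -, rfl⟩; positivity)

/-- The partial products of `Γ`. -/
noncomputable def gamPartial (p : Kernel (Set.Iio (0 : ℤ) → A) A) (j : ℕ) : ℝ :=
  ∏ i ∈ Finset.range j, (1 - variation p i)

/-- A bound for the expected number of future discrepancies between two copies of the chain
whose pasts agree on the last `j` symbols. -/
noncomputable def futureDiscrepancy (p : Kernel (Set.Iio (0 : ℤ) → A) A) (Γ : ℝ) (j : ℕ) : ℝ :=
  1 / Γ - 1 / gamPartial p j

theorem futureDiscrepancy_zero (p : Kernel (Set.Iio (0 : ℤ) → A) A) (Γ : ℝ) :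
    futureDiscrepancy p Γ 0 = 1 / Γ - 1 := by
  simp [futureDiscrepancy, gamPartial]

variable [Countable A] [DiscreteMeasurableSpace A]

theorem half_tsum_abs_le_one (μ ν : Measure A) [IsProbabilityMeasure μ] [IsProbabilityMeasure ν] :
    1 / 2 * ∑' a, |μ.real {a} - ν.real {a}| ≤ 1 := by
  have hs := summable_real_singleton μ
  have ht := summable_real_singleton ν
  have h : ∑' a, |μ.real {a} - ν.real {a}| ≤ ∑' a, (μ.real {a} + ν.real {a}) :=
    (hs.sub ht).abs.tsum_le_tsum (fun a => by
      have hx : 0 ≤ μ.real {a} := measureReal_nonneg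
      have hy : 0 ≤ ν.real {a} := measureReal_nonneg
      exact abs_le.2 ⟨by linarith, by linarith⟩) (hs.add ht)
  rw [hs.tsum_add ht, tsum_real_singleton, tsum_real_singleton] at h
  linarith

theorem half_tsum_abs_le_variation (p : Kernel (Set.Iio (0 : ℤ) → A) A) [IsMarkovKernel p]
    {j : ℕ} {x y : Set.Iio (0 : ℤ) → A} (h : Agree j x y) :
    1 / 2 * ∑' a, |(p x).real {a} - (p y).real {a}| ≤ variation p j :=
  le_csSup ⟨1, by rintro _ ⟨x, y, -, rfl⟩; exact half_tsum_abs_le_one _ _⟩ ⟨x, y, h, rfl⟩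

theorem variation_le_one (p : Kernel (Set.Iio (0 : ℤ) → A) A) [IsMarkovKernel p] (j : ℕ) :
    variation p j ≤ 1 :=
  Real.sSup_le (by rintro _ ⟨x, y, -, rfl⟩; exact half_tsum_abs_le_one _ _) zero_le_one

theorem Gam_le_gamPartial (p : Kernel (Set.Iio (0 : ℤ) → A) A) [IsMarkovKernel p] (j : ℕ) :
    Gam p ≤ gamPartial p j :=
  tprod_le_prod_range_of_mem_Icc (fun i => sub_nonneg.2 (variation_le_one p i))
    (fun i => sub_le_self _ (variation_nonneg p i)) j

variable {p : Kernel (Set.Iio (0 : ℤ) → A) A} {Γ : ℝ}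

variable [IsMarkovKernel p]

theorem futureDiscrepancy_nonneg (hΓ : 0 < Γ) (hp : Γ ≤ Gam p) (j : ℕ) :
    0 ≤ futureDiscrepancy p Γ j :=
  sub_nonneg.2 (one_div_le_one_div_of_le hΓ (hp.trans (Gam_le_gamPartial p j)))

theorem futureDiscrepancy_le (hΓ : 0 < Γ) (hp : Γ ≤ Gam p) (j : ℕ) :
    futureDiscrepancy p Γ j ≤ 1 / Γ :=
  sub_le_self _ (one_div_nonneg.2 (hΓ.le.trans (hp.trans (Gam_le_gamPartial p j))))

/-- One step of the maximal coupling: if the next symbols coincide, the agreement grows to j + 1; if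
not, one discrepancy is paid and the agreement restarts from 0. Paying and restarting costs 1 + (1/Γ
- 1) = 1/Γ. -/
theorem futureDiscrepancy_step (hΓ : 0 < Γ) (hp : Γ ≤ Gam p) (j : ℕ) :
    (1 - variation p j) * futureDiscrepancy p Γ (j + 1)
      + variation p j * (1 + futureDiscrepancy p Γ 0) = futureDiscrepancy p Γ j := by
  have h1 : 0 < gamPartial p (j + 1) := hΓ.trans_le (hp.trans (Gam_le_gamPartial p _))
  have h0 : 0 < gamPartial p j := hΓ.trans_le (hp.trans (Gam_le_gamPartial p _))
  have hs : gamPartial p (j + 1) = gamPartial p j * (1 - variation p j) :=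
    Finset.prod_range_succ _ _
  -- Positivity of Γ makes every partial product, hence every factor, nonzero.
  have hv : 1 - variation p j ≠ 0 := fun h => by rw [hs, h, mul_zero] at h1; exact h1.false
  rw [futureDiscrepancy_zero, futureDiscrepancy, futureDiscrepancy, hs]
  field_simp
  ring

/-- `F` varies by at most `c` per discrepancy among the last `k` symbols, up to the discrepancies
to be expected in the future. -/
def LipPast (p : Kernel (Set.Iio (0 : ℤ) → A) A) (Γ c : ℝ) (k : ℕ)
    (F : (Set.Iio (0 : ℤ) → A) → ℝ) : Prop :=
  ∀ (j : ℕ) (x y : Set.Iio (0 : ℤ) → A), Agree j x y →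
    F x - F y ≤ c * (discrepancy k x y + futureDiscrepancy p Γ j)

/-- Averaging out the newest symbol turns a possible discrepancy there into its expected cost under
the maximal coupling; α is the bound when the two new symbols coincide, β the bound in general. -/
theorem LipPast.transition (hΓ : 0 < Γ) (hp : Γ ≤ Gam p) {c : ℝ} (hc : 0 ≤ c) {k : ℕ}
    {F : (Set.Iio (0 : ℤ) → A) → ℝ} {C : ℝ} (hC : ∀ x, |F x| ≤ C)
    (hF : LipPast p Γ c (k + 1) F) : LipPast p Γ c k (transition p F) := by
  classical
  intro j x y hxy
  have h := integral_sub_integral_le_of_tv (μ := p x) (ν := p y)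
    (f := fun a => F (append x a)) (g := fun a => F (append y a))
    (α := c * (discrepancy k x y + futureDiscrepancy p Γ (j + 1)))
    (β := c * (discrepancy k x y + (1 + futureDiscrepancy p Γ 0)))
    (fun a => hC _) (fun a => hC _) ?_ (fun a => ?_) (fun a b => ?_)
    (half_tsum_abs_le_variation p hxy)
  · refine h.trans_eq ?_
    rw [← futureDiscrepancy_step hΓ hp j]
    ring
  -- α ≤ β, because a restart costs 1/Γ, the largest possible value.
  · refine mul_le_mul_of_nonneg_left ?_ hc
    rw [futureDiscrepancy_zero]
    linarith [futureDiscrepancy_le hΓ hp (j + 1)]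
  · have := hF (j + 1) _ _ (hxy.append a)
    rwa [discrepancy_append, if_pos rfl, add_zero] at this
  · refine (hF 0 _ _ (agree_zero (append x a) (append y b))).trans
      (mul_le_mul_of_nonneg_left ?_ hc)
    rw [discrepancy_append]
    split_ifs <;> linarith

/-- Exponential moments of Lipschitz functions of the past. -/
theorem integral_exp_le_of_lipPast {P : Measure (ℤ → A)} [IsProbabilityMeasure P]
    (hP : IsStationary P) (hcond : IsLeftConditional P p) (hΓ : 0 < Γ) (hp : Γ ≤ Gam p)
    {c : ℝ} (hc : 0 ≤ c) {C : ℝ} (l : ℝ) (k : ℕ) :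
    ∀ F : (Set.Iio (0 : ℤ) → A) → ℝ, Measurable F → (∀ x, |F x| ≤ C) → LipPast p Γ c k F →
      ∫ x, Real.exp (l * F x) ∂(P.map past) ≤
        Real.exp (l * ∫ x, F x ∂(P.map past) + (k + 1) * (l ^ 2 * (c / Γ) ^ 2 / 8)) := by
  classical
  have : IsProbabilityMeasure (P.map (past : (ℤ → A) → _)) :=
    Measure.isProbabilityMeasure_map measurable_past.aemeasurable
  induction k with
  | zero =>
    intro F hF hC hL
    -- All k symbols are averaged out; what is left still depends on the initial past, with
    -- oscillation at most c/Γ. This is the extra 1 in k + 1.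
    have h := integral_exp_le_of_oscillation (μ := P.map past) (K := c / Γ) hF hC (fun x y => ?_) l
    · simpa using h
    · refine (hL 0 x y (agree_zero x y)).trans ?_
      rw [div_eq_mul_one_div]
      refine mul_le_mul_of_nonneg_left ?_ hc
      simpa [discrepancy] using futureDiscrepancy_le hΓ hp 0
  | succ k ih =>
    intro F hF hC hL
    have hexp : Measurable fun x => Real.exp (l * F x) :=
      Real.measurable_exp.comp (hF.const_mul l)
    have hexpC : ∀ x, |Real.exp (l * F x)| ≤ Real.exp (|l| * C) := fun x => by
      rw [abs_of_pos (Real.exp_pos _)]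
      refine Real.exp_le_exp.2 ((le_abs_self _).trans ?_)
      rw [abs_mul]
      exact mul_le_mul_of_nonneg_left (hC x) (abs_nonneg _)
    have hTm := measurable_transition p hF
    have hTC := abs_transition_le p hC
    -- Hoeffding's lemma for the newest symbol given the past x: changing that symbol alone moves F
    -- by at most c(1 + (1/Γ - 1)) = c/Γ.
    have hstep : ∀ x, transition p (fun x => Real.exp (l * F x)) x ≤
        Real.exp (l ^ 2 * (c / Γ) ^ 2 / 8) * Real.exp (l * transition p F x) := fun x => by
      rw [← Real.exp_add, add_comm]
      refine integral_exp_le_of_oscillation (μ := p x) (F := fun a => F (append x a))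
        (measurable_of_countable _) (fun a => hC _) (fun a b => ?_) l
      refine (hL 0 _ _ (agree_zero (append x a) (append x b))).trans ?_
      rw [div_eq_mul_one_div, discrepancy_append, discrepancy_self, futureDiscrepancy_zero]
      refine mul_le_mul_of_nonneg_left ?_ hc
      split_ifs <;> linarith
    calc ∫ x, Real.exp (l * F x) ∂(P.map past)
        = ∫ x, transition p (fun x => Real.exp (l * F x)) x ∂(P.map past) :=
          (integral_transition hP hcond hexp hexpC).symm
      _ ≤ ∫ x, Real.exp (l ^ 2 * (c / Γ) ^ 2 / 8) * Real.exp (l * transition p F x)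
            ∂(P.map past) :=
          integral_mono (integrable_of_abs_le (measurable_transition p hexp)
            (abs_transition_le p hexpC)) ((integrable_exp_of_abs_le hTm hTC l).const_mul _) hstep
      _ ≤ Real.exp (l ^ 2 * (c / Γ) ^ 2 / 8) *
            Real.exp (l * ∫ x, transition p F x ∂(P.map past)
              + (k + 1) * (l ^ 2 * (c / Γ) ^ 2 / 8)) := by
          rw [integral_const_mul]
          exact mul_le_mul_of_nonneg_left (ih _ hTm hTC (hL.transition hΓ hp hc hC))
            (Real.exp_pos _).le
      _ = _ := by
          rw [← Real.exp_add, integral_transition hP hcond hF hC]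
          push_cast
          ring_nf

open scoped Classical in
/-- Functions of the sample of size `n` that vary by at most `c` when one symbol is changed are
sub-Gaussian. -/
theorem hasSubgaussianMGF_sample {P : Measure (ℤ → A)} [IsProbabilityMeasure P]
    (hP : IsStationary P) (hcond : IsLeftConditional P p) (hΓ : 0 < Γ) (hp : Γ ≤ Gam p)
    {c : NNReal} {C : ℝ} {n : ℕ} {Φ : (Finset.Icc (1 : ℤ) n → A) → ℝ} (hC : ∀ x, |Φ x| ≤ C)
    (hΦ : ∀ x y, Φ x - Φ y ≤ c * (Finset.univ.filter fun i => x i ≠ y i).card) :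
    HasSubgaussianMGF (fun x => Φ (sample n x) - ∫ y, Φ (sample n y) ∂P)
      ((n + 1) * (c / Γ.toNNReal) ^ 2 / 4) P := by
  have hsample : Measurable (sample n : (ℤ → A) → _) :=
    measurable_pi_lambda _ fun _ => measurable_pi_apply _
  have hΦm : Measurable Φ := measurable_of_countable _
  have hcm : Measurable fun x => Φ (sample n x) := hΦm.comp hsample
  -- Shifting by -1 - n moves the sample to the times -n, …, -1, the last n symbols of the past.
  set r : (Set.Iio (0 : ℤ) → A) → (Finset.Icc (1 : ℤ) n → A) := fun s i =>
    s ⟨(i : ℤ) + (-1 - n), by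
      have := (Finset.mem_Icc.1 i.2).2
      simp only [Set.mem_Iio]
      omega⟩
  have hrm : Measurable r := measurable_pi_lambda _ fun _ => measurable_pi_apply _
  have hshift : Measurable fun (x : ℤ → A) (i : ℤ) => x (i + (-1 - n)) :=
    measurable_pi_lambda _ fun _ => measurable_pi_apply _
  have htransfer : ∀ g : ℝ → ℝ, Measurable g →
      ∫ x, g (Φ (sample n x)) ∂P = ∫ s, g (Φ (r s)) ∂(P.map past) := fun g hg => by
    conv_lhs => rw [← hP (-1 - n)]
    rw [integral_map hshift.aemeasurable (show Measurable fun x => g (Φ (sample n x)) from hg.comp hcm).aestronglyMeasurable,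
      integral_map measurable_past.aemeasurable
        (show Measurable fun s => g (Φ (r s)) from
          hg.comp (hΦm.comp hrm)).aestronglyMeasurable]
    rfl
  have hL : LipPast p Γ c n fun s => Φ (r s) := fun j x y _ => by
    refine (hΦ _ _).trans (mul_le_mul_of_nonneg_left ?_ c.coe_nonneg)
    refine le_trans ?_ (le_add_of_nonneg_right (futureDiscrepancy_nonneg hΓ hp j))
    rw [discrepancy, Finset.sum_ite, Finset.sum_const_zero, zero_add, Finset.sum_const,
      nsmul_eq_mul, mul_one]
    norm_cast
    -- Sample position i sits at time i - 1 - n, which `back` numbers n - i.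
    refine Finset.card_le_card_of_injOn (fun i => (n - (i : ℤ)).toNat) (fun i hi => ?_) ?_
    · have h1 := Finset.mem_Icc.1 i.2
      have h2 : -(((n - (i : ℤ)).toNat : ℤ) + 1) = i + (-1 - n) := by omega
      simp only [Finset.mem_coe, Finset.mem_filter, Finset.mem_univ, true_and] at hi
      refine Finset.mem_coe.2 (Finset.mem_filter.2
        ⟨Finset.mem_range.2 (by simp only; omega), ?_⟩)
      simpa only [back, h2] using hi
    · intro i _ i' _ h
      have h1 := Finset.mem_Icc.1 i.2
      have h2 := Finset.mem_Icc.1 i'.2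
      simp only at h
      exact Subtype.ext (by omega)
  refine ⟨fun t => ?_, fun t => ?_⟩
  · refine integrable_exp_of_abs_le (C := C + C) (hcm.sub_const _) (fun x => ?_) t
    refine (abs_sub _ _).trans (add_le_add (hC _) ?_)
    have h := norm_integral_le_of_norm_le_const (μ := P) (f := fun x => Φ (sample n x)) (C := C)
      (ae_of_all _ fun a => hC _)
    simpa using h
  · have h := integral_exp_le_of_lipPast hP hcond hΓ hp c.coe_nonneg t n (fun s => Φ (r s))
      (hΦm.comp hrm) (fun s => hC _) hL
    rw [← htransfer (fun z => z) measurable_id, ← htransfer (fun z => Real.exp (t * z))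
      (Real.measurable_exp.comp (measurable_id.const_mul t))] at h
    set I := ∫ x, Φ (sample n x) ∂P
    calc mgf (fun x => Φ (sample n x) - I) P t
        = Real.exp (-(t * I)) * ∫ x, Real.exp (t * Φ (sample n x)) ∂P := by
          rw [mgf, ← integral_const_mul]
          refine integral_congr_ae (ae_of_all _ fun x => ?_)
          simp only [← Real.exp_add]
          ring_nf
      _ ≤ _ := mul_le_mul_of_nonneg_left h (Real.exp_pos _).le
      _ = _ := by
          rw [← Real.exp_add]
          push_cast
          rw [Real.coe_toNNReal _ hΓ.le]
          congr 1
          ring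

end Concentration
end Guessing

namespace Guessing

/-! ### Counts of windows: sensitivity to one symbol, and means. -/

section Counting

variable {A : Type*} {n : ℕ} {D G : Finset ℤ}

/-- The sample `x` reads `b` on `D + i` and `a` on `G + i`, and these are contained in
`{1, …, n}`. -/
def Occurs (x : Finset.Icc (1 : ℤ) n → A) (b : D → A) (a : G → A) (i : ℕ) : Prop :=
  (∀ j : D, ∃ h : (j : ℤ) + i ∈ Finset.Icc (1 : ℤ) n, x ⟨(j : ℤ) + i, h⟩ = b j) ∧
  (∀ j : G, ∃ h : (j : ℤ) + i ∈ Finset.Icc (1 : ℤ) n, x ⟨(j : ℤ) + i, h⟩ = a j)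

/-- The windows `D + i` and `G + i` are contained in `{1, …, n}`. -/
def Fits (n : ℕ) (D G : Finset ℤ) (i : ℕ) : Prop :=
  (∀ j : D, (j : ℤ) + i ∈ Finset.Icc (1 : ℤ) n) ∧ (∀ j : G, (j : ℤ) + i ∈ Finset.Icc (1 : ℤ) n)

open scoped Classical in
/-- The number of positions at which both windows are contained in `{1, …, n}`. -/
noncomputable def windows (n : ℕ) (D G : Finset ℤ) : ℕ :=
  ((Finset.range n).filter (Fits n D G)).card

open scoped Classical in
/-- The positions at which the windows of `x` and `y` differ. -/
noncomputable def differing (D G : Finset ℤ) (x y : Finset.Icc (1 : ℤ) n → A) : Finset ℕ :=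
  (Finset.range n).filter fun i => ∃ j ∈ D ∪ G, ∃ h : j + i ∈ Finset.Icc (1 : ℤ) n,
    x ⟨j + i, h⟩ ≠ y ⟨j + i, h⟩

open scoped Classical in
theorem count_eq_sum (x : Finset.Icc (1 : ℤ) n → A) (b : D → A) (a : G → A) :
    (count n D G x b a : ℝ) = ∑ i ∈ Finset.range n, if Occurs x b a i then 1 else 0 := by
  rw [Finset.sum_boole, count]
  congr!

theorem count_le (x : Finset.Icc (1 : ℤ) n → A) (b : D → A) (a : G → A) :
    (count n D G x b a : ℝ) ≤ n := by
  classical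
  have h : count n D G x b a ≤ (Finset.range n).card := Finset.card_filter_le _ _
  rw [Finset.card_range] at h
  exact_mod_cast h

theorem Occurs.unique {x : Finset.Icc (1 : ℤ) n → A} {b : D → A} {a a' : G → A} {i : ℕ}
    (h : Occurs x b a i) (h' : Occurs x b a' i) : a = a' := by
  funext j
  obtain ⟨_, e⟩ := h.2 j
  obtain ⟨_, e'⟩ := h'.2 j
  exact e.symm.trans e'

theorem occurs_congr {x y : Finset.Icc (1 : ℤ) n → A} {i : ℕ} (hi : i ∈ Finset.range n)
    (h : i ∉ differing D G x y) (b : D → A) (a : G → A) : Occurs x b a i ↔ Occurs y b a i := by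
  classical
  have hxy : ∀ j ∈ D ∪ G, ∀ h : j + i ∈ Finset.Icc (1 : ℤ) n, x ⟨j + i, h⟩ = y ⟨j + i, h⟩ := by
    intro j hj hm
    by_contra hne
    exact h (Finset.mem_filter.2 ⟨hi, j, hj, hm, hne⟩)
  refine and_congr (forall_congr' fun j => exists_congr fun hm => ?_)
    (forall_congr' fun j => exists_congr fun hm => ?_)
  · rw [hxy _ (Finset.mem_union_left _ j.2) hm]
  · rw [hxy _ (Finset.mem_union_right _ j.2) hm]

open scoped Classical in
-- A window position is recovered from an altered symbol and its offset in D ∪ G.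
theorem card_differing_le (x y : Finset.Icc (1 : ℤ) n → A) :
    (differing D G x y).card
      ≤ (G.card + D.card) * (Finset.univ.filter fun i => x i ≠ y i).card := by
  have hsub : differing D G x y ⊆
      ((D ∪ G) ×ˢ (Finset.univ.filter fun i => x i ≠ y i)).image
        (fun z => ((z.2 : ℤ) - z.1).toNat) := by
    intro i hi
    obtain ⟨_, j, hj, hm, hne⟩ := Finset.mem_filter.1 hi
    refine Finset.mem_image.2 ⟨(j, ⟨j + i, hm⟩), Finset.mem_product.2 ⟨hj, ?_⟩, ?_⟩
    · exact Finset.mem_filter.2 ⟨Finset.mem_univ _, hne⟩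
    · simp
  refine (Finset.card_le_card hsub).trans (Finset.card_image_le.trans ?_)
  rw [Finset.card_product]
  refine Nat.mul_le_mul_right _ ((Finset.card_union_le _ _).trans (add_comm _ _).le)

/-- A sum over positions changes by at most `r` per position at which the windows differ. -/
theorem sum_range_sub_le (x y : Finset.Icc (1 : ℤ) n → A) {r : ℝ} (u v : ℕ → ℝ)
    (heq : ∀ i ∈ Finset.range n, i ∉ differing D G x y → u i = v i) (hr : ∀ i, u i - v i ≤ r) :
    ∑ i ∈ Finset.range n, u i - ∑ i ∈ Finset.range n, v i ≤ r * (differing D G x y).card := by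
  classical
  have hsub : differing D G x y ⊆ Finset.range n := Finset.filter_subset _ _
  rw [← Finset.sum_sub_distrib, ← Finset.sum_subset hsub fun i hi h => by
    rw [heq i hi h, sub_self], mul_comm, ← nsmul_eq_mul]
  exact Finset.sum_le_card_nsmul _ _ _ fun i _ => hr i

theorem count_sub_count_le (x y : Finset.Icc (1 : ℤ) n → A) (b : D → A) (a : G → A) :
    (count n D G x b a : ℝ) - count n D G y b a ≤ (differing D G x y).card := by
  classical
  rw [count_eq_sum, count_eq_sum, ← one_mul ((differing D G x y).card : ℝ)]
  refine sum_range_sub_le x y _ _ (fun i hi h => ?_) fun i => ?_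
  · simp only [occurs_congr hi h]
  · split_ifs <;> norm_num

/-- At each position at most one a occurs, so the position contributes a number in [-1, 1] whatever
the size of `s`; this makes the bound free of `s`. -/
theorem signedCount_sub_le (x y : Finset.Icc (1 : ℤ) n → A) (b : D → A) (s : Finset (G → A))
    {w : (G → A) → ℝ} (hw : ∀ a, |w a| = 1) :
    ∑ a ∈ s, w a * (count n D G x b a : ℝ) - ∑ a ∈ s, w a * (count n D G y b a : ℝ)
      ≤ 2 * (differing D G x y).card := by
  classical
  have hsum : ∀ z : Finset.Icc (1 : ℤ) n → A, ∑ a ∈ s, w a * (count n D G z b a : ℝ)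
      = ∑ i ∈ Finset.range n, ∑ a ∈ s, if Occurs z b a i then w a else 0 := fun z => by
    rw [Finset.sum_comm]
    refine Finset.sum_congr rfl fun a _ => ?_
    rw [count_eq_sum, Finset.mul_sum]
    simp
  have hbound : ∀ (z : Finset.Icc (1 : ℤ) n → A) (i : ℕ),
      |∑ a ∈ s, if Occurs z b a i then w a else 0| ≤ 1 := fun z i => by
    by_cases h : ∃ a ∈ s, Occurs z b a i
    · obtain ⟨a, ha, ho⟩ := h
      rw [Finset.sum_eq_single_of_mem a ha fun a' _ hne => if_neg fun ho' =>
        hne (ho'.unique ho), if_pos ho, hw]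
    · push Not at h
      rw [Finset.sum_eq_zero fun a ha => if_neg (h a ha)]
      simp
  rw [hsum, hsum]
  refine sum_range_sub_le x y _ _ (fun i hi h => ?_) fun i => ?_
  · simp only [occurs_congr hi h]
  · have h1 := abs_le.1 (hbound x i)
    have h2 := abs_le.1 (hbound y i)
    linarith

theorem windows_ge (D G : Finset ℤ) : ∃ M : ℕ, ∀ n : ℕ, (n : ℝ) - M ≤ windows n D G := by
  classical
  obtain ⟨M, hM⟩ : ∃ M : ℕ, ∀ j ∈ D ∪ G, |j| ≤ M := by
    refine ⟨∑ j ∈ D ∪ G, j.natAbs, fun j hj => ?_⟩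
    rw [Int.abs_eq_natAbs]
    exact_mod_cast Finset.single_le_sum (f := fun j : ℤ => j.natAbs) (fun _ _ => Nat.zero_le _) hj
  refine ⟨2 * M + 1, fun n => ?_⟩
  have hsub : Finset.Ico (M + 1) (n - M) ⊆ (Finset.range n).filter (Fits n D G) := by
    intro i hi
    have hi' := Finset.mem_Ico.1 hi
    refine Finset.mem_filter.2 ⟨Finset.mem_range.2 (by omega), fun j => ?_, fun j => ?_⟩
    · have := abs_le.1 (hM j (Finset.mem_union_left _ j.2))
      exact Finset.mem_Icc.2 (by omega)
    · have := abs_le.1 (hM j (Finset.mem_union_right _ j.2))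
      exact Finset.mem_Icc.2 (by omega)
  have h := Finset.card_le_card hsub
  rw [Nat.card_Ico] at h
  have h2 : n ≤ windows n D G + (2 * M + 1) := by
    rw [windows]
    omega
  rw [sub_le_iff_le_add]
  exact_mod_cast h2

theorem windows_le (n : ℕ) (D G : Finset ℤ) : (windows n D G : ℝ) ≤ n := by
  classical
  have h : windows n D G ≤ (Finset.range n).card := Finset.card_filter_le _ _
  rw [Finset.card_range] at h
  exact_mod_cast h

theorem occurs_sample_iff (x : ℤ → A) (b : D → A) (a : G → A) (i : ℕ) :
    Occurs (sample n x) b a i ↔ Fits n D G i ∧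
      restr G (fun k => x (k + i)) = a ∧ restr D (fun k => x (k + i)) = b := by
  constructor
  · intro h
    refine ⟨⟨fun j => (h.1 j).1, fun j => (h.2 j).1⟩, funext fun j => ?_, funext fun j => ?_⟩
    · exact (h.2 j).2
    · exact (h.1 j).2
  · rintro ⟨⟨h1, h2⟩, ha, hb⟩
    exact ⟨fun j => ⟨h1 j, congrFun hb j⟩, fun j => ⟨h2 j, congrFun ha j⟩⟩

variable [MeasurableSpace A]

/-- The joint law of the windows: the probability that `X_G = a` and `X_D = b`. -/
noncomputable def joint (P : Measure (ℤ → A)) (b : D → A) (a : G → A) : ℝ :=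
  P.real {y | restr G y = a ∧ restr D y = b}

theorem joint_nonneg (P : Measure (ℤ → A)) (b : D → A) (a : G → A) : 0 ≤ joint P b a :=
  measureReal_nonneg

theorem joint_le_one (P : Measure (ℤ → A)) [IsProbabilityMeasure P] (b : D → A) (a : G → A) :
    joint P b a ≤ 1 :=
  measureReal_le_one

theorem measurable_restr (H : Finset ℤ) : Measurable (restr H : (ℤ → A) → _) :=
  measurable_pi_lambda _ fun _ => measurable_pi_apply _

theorem measurable_sample (n : ℕ) : Measurable (sample n : (ℤ → A) → _) :=
  measurable_restr _

variable [Countable A] [DiscreteMeasurableSpace A]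

theorem measurableSet_joint (b : D → A) (a : G → A) :
    MeasurableSet {y : ℤ → A | restr G y = a ∧ restr D y = b} :=
  (measurable_restr G (measurableSet_singleton a)).inter
    (measurable_restr D (measurableSet_singleton b))

/-- By stationarity each window that fits contributes the same probability. -/
theorem integral_count {P : Measure (ℤ → A)} [IsProbabilityMeasure P] (hP : IsStationary P)
    (b : D → A) (a : G → A) :
    ∫ x, (count n D G (sample n x) b a : ℝ) ∂P = windows n D G * joint P b a := by
  classical
  have hshift : ∀ i : ℕ, Measurable fun (x : ℤ → A) (k : ℤ) => x (k + i) := fun i =>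
    measurable_pi_lambda _ fun _ => measurable_pi_apply _
  have hterm : ∀ i : ℕ, (fun x => if Occurs (sample n x) b a i then (1 : ℝ) else 0)
      = if Fits n D G i then ((fun (x : ℤ → A) (k : ℤ) => x (k + i)) ⁻¹'
          {y | restr G y = a ∧ restr D y = b}).indicator (fun _ => 1) else 0 := fun i => by
    funext x
    by_cases hi : Fits n D G i
    · simp [occurs_sample_iff, hi, Set.indicator_apply]
    · simp [occurs_sample_iff, hi]
  have hms : ∀ i : ℕ, MeasurableSet ((fun (x : ℤ → A) (k : ℤ) => x (k + i)) ⁻¹'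
      {y | restr G y = a ∧ restr D y = b}) := fun i => hshift i (measurableSet_joint b a)
  have hval : ∀ i : ℕ, ∫ x, (if Occurs (sample n x) b a i then (1 : ℝ) else 0) ∂P
      = if Fits n D G i then joint P b a else 0 := fun i => by
    rw [hterm]
    split_ifs
    · rw [integral_indicator_const _ (hms i), smul_eq_mul, mul_one, joint,
        measureReal_def, measureReal_def, ← Measure.map_apply (hshift i) (measurableSet_joint b a),
        hP i]
    · simp
  simp only [count_eq_sum]
  rw [integral_finsetSum _ fun i _ => ?_]
  · simp only [hval]
    rw [← Finset.sum_filter, Finset.sum_const, nsmul_eq_mul, windows]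
  · rw [hterm]
    split_ifs
    · exact (integrable_const 1).indicator (hms i)
    · exact integrable_zero _ _ _

end Counting
end Guessing

namespace Guessing

/-! ### The largest deviation of the counts: mean and tail. -/

section Deviation

/-- The signs can be chosen so that all cross terms are nonnegative. -/
theorem exists_signs_sum_integral_sq_le {Ω ι : Type*} [MeasurableSpace Ω] {μ : Measure Ω}
    {z : ι → Ω → ℝ} (hz : ∀ i j, Integrable (fun x => z i x * z j x) μ) (s : Finset ι) :
    ∃ w : ι → ℝ, (∀ i, |w i| = 1) ∧
      ∑ i ∈ s, ∫ x, z i x ^ 2 ∂μ ≤ ∫ x, (∑ i ∈ s, w i * z i x) ^ 2 ∂μ := by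
  classical
  induction s using Finset.induction_on with
  | empty => exact ⟨fun _ => 1, by simp, by simp⟩
  | insert k s hk ih =>
    obtain ⟨w, hw, h⟩ := ih
    set v : Ω → ℝ := fun x => ∑ i ∈ s, w i * z i x with hv
    have hvz : ∀ j, Integrable (fun x => v x * z j x) μ := fun j => by
      simp only [hv, Finset.sum_mul, mul_assoc]
      exact integrable_finsetSum _ fun i _ => (hz i j).const_mul _
    have hvv : Integrable (fun x => v x ^ 2) μ := by
      have : (fun x => v x ^ 2) = fun x => ∑ i ∈ s, w i * (v x * z i x) := by
        funext x
        rw [sq]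
        nth_rewrite 2 [hv]
        simp only [Finset.mul_sum]
        exact Finset.sum_congr rfl fun i _ => by ring
      rw [this]
      exact integrable_finsetSum _ fun i _ => (hvz i).const_mul _
    obtain ⟨e, he, hcross⟩ : ∃ e : ℝ, |e| = 1 ∧ 0 ≤ e * ∫ x, v x * z k x ∂μ := by
      rcases le_total 0 (∫ x, v x * z k x ∂μ) with h0 | h0
      · exact ⟨1, by simp, by simpa using h0⟩
      · exact ⟨-1, by simp, by linarith⟩
    refine ⟨Function.update w k e, fun i => ?_, ?_⟩
    · by_cases hi : i = k
      · rw [hi, Function.update_self, he]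
      · rw [Function.update_of_ne hi, hw]
    · have he2 : e ^ 2 = 1 := by rw [← sq_abs, he, one_pow]
      have hsq : (fun x => (∑ i ∈ insert k s, Function.update w k e i * z i x) ^ 2)
          = fun x => z k x ^ 2 + (2 * e) * (v x * z k x) + v x ^ 2 := by
        funext x
        rw [Finset.sum_insert hk, Function.update_self]
        have : ∑ i ∈ s, Function.update w k e i * z i x = v x :=
          Finset.sum_congr rfl fun i hi => by
            rw [Function.update_of_ne (ne_of_mem_of_not_mem hi hk)]
        rw [this]
        linear_combination (z k x ^ 2) * he2
      have hkk : Integrable (fun x => z k x ^ 2) μ := by simpa only [sq] using hz k k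
      have hcr : Integrable (fun x => 2 * e * (v x * z k x)) μ := (hvz k).const_mul _
      rw [Finset.sum_insert hk, hsq,
        integral_add (f := fun x => z k x ^ 2 + 2 * e * (v x * z k x)) (hkk.add hcr) hvv,
        integral_add hkk hcr, integral_const_mul]
      linarith

/-- Integrate 2 + z²/2 ≤ e^z + e^(-z) at z = tX. With t² = 2/c both exponential moments are at most
e, and 2e - 2 ≤ 4. -/
theorem integral_sq_le_of_hasSubgaussianMGF {Ω : Type*} [MeasurableSpace Ω] {μ : Measure Ω}
    [IsProbabilityMeasure μ] {X : Ω → ℝ} {c : NNReal} (h : HasSubgaussianMGF X c μ) :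
    ∫ x, X x ^ 2 ∂μ ≤ 4 * c := by
  rcases eq_or_ne c 0 with rfl | hc
  · have h0 := h.ae_eq_zero_of_hasSubgaussianMGF_zero
    rw [integral_congr_ae (g := fun _ => (0 : ℝ)) (h0.mono fun x hx => by simp [hx])]
    simp
  have hc' : (0 : ℝ) < c := by exact_mod_cast pos_iff_ne_zero.2 hc
  set t := √(2 / c)
  have ht2 : t ^ 2 = 2 / c := Real.sq_sqrt (by positivity)
  have hpt : ∀ z : ℝ, 2 + z ^ 2 / 2 ≤ Real.exp z + Real.exp (-z) := fun z => by
    rcases le_total 0 z with hz | hz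
    · linarith [Real.quadratic_le_exp_of_nonneg hz, Real.add_one_le_exp (-z)]
    · have := Real.quadratic_le_exp_of_nonneg (neg_nonneg.2 hz)
      rw [neg_sq] at this
      linarith [Real.add_one_le_exp z]
  have hX2 : Integrable (fun x => X x ^ 2) μ := (h.memLp 2).integrable_sq
  have hi1 := h.integrable_exp_mul t
  have hi2 := h.integrable_exp_mul (-t)
  have hmono : ∫ x, (2 + t ^ 2 / 2 * X x ^ 2) ∂μ
      ≤ ∫ x, (Real.exp (t * X x) + Real.exp (-t * X x)) ∂μ := by
    refine integral_mono ((integrable_const _).add (hX2.const_mul _)) (hi1.add hi2) fun x => ?_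
    have := hpt (t * X x)
    rw [← neg_mul] at this
    simp only
    linarith [mul_pow t (X x) 2]
  rw [integral_add (integrable_const _) (hX2.const_mul _), integral_add hi1 hi2,
    integral_const_mul] at hmono
  have hm1 := h.mgf_le t
  have hm2 := h.mgf_le (-t)
  have hexp : (c : ℝ) * t ^ 2 / 2 = 1 := by rw [ht2]; field_simp
  rw [neg_sq, hexp] at hm2
  rw [hexp] at hm1
  simp only [mgf] at hm1 hm2
  have he := Real.exp_one_lt_d9
  simp only [integral_const, probReal_univ, smul_eq_mul, one_mul] at hmono
  have hfin : 1 / (c : ℝ) * ∫ x, X x ^ 2 ∂μ ≤ 4 := by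
    have : t ^ 2 / 2 = 1 / (c : ℝ) := by rw [ht2]; ring
    rw [← this]
    linarith
  rw [one_div, inv_mul_le_iff₀ hc'] at hfin
  linarith

variable {A : Type*} {n : ℕ} {D G : Finset ℤ}

open scoped Classical in
theorem natCast_mul_card_differing_le (r : ℕ) (x y : Finset.Icc (1 : ℤ) n → A) :
    (r : ℝ) * (differing D G x y).card ≤ ((r * (G.card + D.card) : ℕ) : NNReal) *
      (Finset.univ.filter fun i => x i ≠ y i).card := by
  have h := Nat.mul_le_mul_left r (card_differing_le (D := D) (G := G) x y)
  rw [← mul_assoc] at h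
  exact_mod_cast h

variable [MeasurableSpace A]

/-- The largest deviation of the counts from their means. -/
noncomputable def maxDeviation (P : Measure (ℤ → A)) (b : D → A) (G : Finset ℤ)
    (x : Finset.Icc (1 : ℤ) n → A) : ℝ :=
  ⨆ a : G → A, |(count n D G x b a : ℝ) - windows n D G * joint P b a|

theorem abs_deviation_le (P : Measure (ℤ → A)) [IsProbabilityMeasure P]
    (x : Finset.Icc (1 : ℤ) n → A) (b : D → A) (a : G → A) :
    |(count n D G x b a : ℝ) - windows n D G * joint P b a| ≤ n := by
  have h1 := count_le x b a
  have h2 : (0 : ℝ) ≤ count n D G x b a := Nat.cast_nonneg _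
  have h3 : (0 : ℝ) ≤ windows n D G * joint P b a :=
    mul_nonneg (Nat.cast_nonneg _) (joint_nonneg _ _ _)
  have h4 : windows n D G * joint P b a ≤ (n : ℝ) :=
    (mul_le_of_le_one_right (Nat.cast_nonneg _) (joint_le_one _ _ _)).trans (windows_le n D G)
  exact abs_le.2 ⟨by linarith, by linarith⟩

theorem abs_deviation_le_maxDeviation (P : Measure (ℤ → A)) [IsProbabilityMeasure P]
    (x : Finset.Icc (1 : ℤ) n → A) (b : D → A) (a : G → A) :
    |(count n D G x b a : ℝ) - windows n D G * joint P b a| ≤ maxDeviation P b G x :=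
  le_ciSup (f := fun a : G → A => |(count n D G x b a : ℝ) - windows n D G * joint P b a|)
    ⟨n, by rintro _ ⟨a, rfl⟩; exact abs_deviation_le P x b a⟩ a

theorem maxDeviation_nonneg (P : Measure (ℤ → A)) (x : Finset.Icc (1 : ℤ) n → A) (b : D → A) :
    0 ≤ maxDeviation P b G x :=
  Real.iSup_nonneg fun _ => abs_nonneg _

theorem abs_maxDeviation_le (P : Measure (ℤ → A)) [IsProbabilityMeasure P]
    (x : Finset.Icc (1 : ℤ) n → A) (b : D → A) : |maxDeviation P b G x| ≤ n := by
  rw [abs_of_nonneg (maxDeviation_nonneg P x b)]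
  exact Real.iSup_le (fun a => abs_deviation_le P x b a) (Nat.cast_nonneg _)

theorem maxDeviation_sub_le (P : Measure (ℤ → A)) [IsProbabilityMeasure P]
    (x y : Finset.Icc (1 : ℤ) n → A) (b : D → A) :
    maxDeviation P b G x - maxDeviation P b G y ≤ (differing D G x y).card := by
  rw [sub_le_iff_le_add]
  refine Real.iSup_le (fun a => ?_) (add_nonneg (Nat.cast_nonneg _) (maxDeviation_nonneg P y b))
  have h1 := count_sub_count_le x y b a
  have h2 := count_sub_count_le y x b a
  have h3 : (differing D G y x) = differing D G x y := by
    classical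
    exact Finset.filter_congr fun i _ => exists_congr fun j => and_congr_right fun _ =>
      exists_congr fun h => ne_comm
  rw [h3] at h2
  have h4 := abs_le.1 (abs_deviation_le_maxDeviation P y b a)
  exact abs_le.2 ⟨by linarith, by linarith⟩

variable [Countable A] [DiscreteMeasurableSpace A] {p : Kernel (Set.Iio (0 : ℤ) → A) A}
  [IsMarkovKernel p] {P : Measure (ℤ → A)} {Γ : ℝ}

theorem measurable_deviation (b : D → A) (a : G → A) :
    Measurable fun x => (count n D G (sample n x) b a : ℝ) - windows n D G * joint P b a :=
  (measurable_of_countable fun x : Finset.Icc (1 : ℤ) n → A =>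
    (count n D G x b a : ℝ) - windows n D G * joint P b a).comp (measurable_sample n)

variable [IsProbabilityMeasure P]

theorem hasSubgaussianMGF_maxDeviation (hP : IsStationary P) (hcond : IsLeftConditional P p)
    (hΓ : 0 < Γ) (hp : Γ ≤ Gam p) (b : D → A) :
    HasSubgaussianMGF (fun x => maxDeviation P b G (sample n x)
        - ∫ y, maxDeviation P b G (sample n y) ∂P)
      ((n + 1) * (((1 * (G.card + D.card) : ℕ) : NNReal) / Γ.toNNReal) ^ 2 / 4) P :=
  hasSubgaussianMGF_sample hP hcond hΓ hp (fun x => abs_maxDeviation_le P x b) fun x y =>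
    (maxDeviation_sub_le P x y b).trans
      (by simpa using natCast_mul_card_differing_le (D := D) (G := G) 1 x y)

theorem sum_integral_sq_deviation_le (hP : IsStationary P) (hcond : IsLeftConditional P p)
    (hΓ : 0 < Γ) (hp : Γ ≤ Gam p) (b : D → A) (s : Finset (G → A)) :
    ∑ a ∈ s, ∫ x, ((count n D G (sample n x) b a : ℝ) - windows n D G * joint P b a) ^ 2 ∂P
      ≤ (n + 1) * (2 * (G.card + D.card) / Γ) ^ 2 := by
  obtain ⟨w, hw, h⟩ := exists_signs_sum_integral_sq_le (μ := P)
    (z := fun (a : G → A) x => (count n D G (sample n x) b a : ℝ) - windows n D G * joint P b a)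
    (fun a a' => integrable_of_abs_le (C := n * n)
      ((measurable_deviation b a).mul (measurable_deviation b a')) fun x => by
        rw [abs_mul]
        exact mul_le_mul (abs_deviation_le P _ b a) (abs_deviation_le P _ b a') (abs_nonneg _)
          (Nat.cast_nonneg _)) s
  refine h.trans ?_
  have hsub := hasSubgaussianMGF_sample hP hcond hΓ hp
    (c := ((2 * (G.card + D.card) : ℕ) : NNReal)) (C := s.card * n) (n := n)
    (Φ := fun x => ∑ a ∈ s, w a * (count n D G x b a : ℝ))
    (fun x => (Finset.abs_sum_le_sum_abs _ _).trans (by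
      rw [← nsmul_eq_mul]
      refine Finset.sum_le_card_nsmul _ _ _ fun a _ => ?_
      rw [abs_mul, hw, one_mul, Nat.abs_cast]
      exact count_le x b a))
    (fun x y => (signedCount_sub_le x y b s hw).trans
      (by simpa using natCast_mul_card_differing_le (D := D) (G := G) 2 x y))
  have hcount : ∀ a : G → A, Integrable (fun x => (count n D G (sample n x) b a : ℝ)) P :=
    fun a => integrable_of_abs_le (C := n) ((measurable_of_countable
      fun x : Finset.Icc (1 : ℤ) n → A => (count n D G x b a : ℝ)).comp (measurable_sample n))
      fun x => by rw [Nat.abs_cast]; exact count_le _ b a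
  have hint : ∫ x, ∑ a ∈ s, w a * (count n D G (sample n x) b a : ℝ) ∂P
      = ∑ a ∈ s, w a * (windows n D G * joint P b a) := by
    rw [integral_finsetSum _ fun a _ => (hcount a).const_mul _]
    exact Finset.sum_congr rfl fun a _ => by rw [integral_const_mul, integral_count hP]
  have h2 := integral_sq_le_of_hasSubgaussianMGF hsub
  rw [hint] at h2
  simp only [← Finset.sum_sub_distrib, ← mul_sub] at h2
  refine h2.trans_eq ?_
  push_cast
  rw [Real.coe_toNNReal _ hΓ.le]
  ring

theorem integral_maxDeviation_le (hP : IsStationary P) (hcond : IsLeftConditional P p)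
    (hΓ : 0 < Γ) (hp : Γ ≤ Gam p) (b : D → A) :
    ∫ x, maxDeviation P b G (sample n x) ∂P ≤ √(n + 1) * (2 * (G.card + D.card) / Γ) := by
  set B : ℝ := (n + 1) * (2 * (G.card + D.card) / Γ) ^ 2
  have hB0 : 0 ≤ B := by positivity
  have hZm : Measurable fun x => maxDeviation P b G (sample n x) :=
    (measurable_of_countable (maxDeviation (n := n) P b G)).comp (measurable_sample n)
  have hZi : Integrable (fun x => maxDeviation P b G (sample n x)) P :=
    integrable_of_abs_le hZm fun x => abs_maxDeviation_le P _ b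
  have hZ2i : Integrable (fun x => maxDeviation P b G (sample n x) ^ 2) P :=
    integrable_of_abs_le (C := (n : ℝ) ^ 2) (hZm.pow_const 2) fun x => by
      rw [abs_pow]
      exact pow_le_pow_left₀ (abs_nonneg _) (abs_maxDeviation_le P _ b) 2
  have hdi : ∀ a : G → A, Integrable (fun x =>
      ((count n D G (sample n x) b a : ℝ) - windows n D G * joint P b a) ^ 2) P := fun a =>
    integrable_of_abs_le (C := (n : ℝ) ^ 2) ((measurable_deviation b a).pow_const 2) fun x => by
      rw [abs_pow]
      exact pow_le_pow_left₀ (abs_nonneg _) (abs_deviation_le P _ b a) 2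
  -- The sum over a may be infinite, so the comparison is made in `ENNReal`, where the sum is the
  -- supremum of its finite partial sums and the bound uniform in `s` applies.
  have hpt : ∀ x : ℤ → A, ENNReal.ofReal (maxDeviation P b G (sample n x) ^ 2) ≤
      ∑' a : G → A, ENNReal.ofReal
        (((count n D G (sample n x) b a : ℝ) - windows n D G * joint P b a) ^ 2) := fun x => by
    set T := ∑' a : G → A, ENNReal.ofReal
        (((count n D G (sample n x) b a : ℝ) - windows n D G * joint P b a) ^ 2)
    rcases eq_or_ne T ⊤ with htop | htop
    · rw [htop]; exact le_top
    rw [ENNReal.ofReal_le_iff_le_toReal htop]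
    have hZ : maxDeviation P b G (sample n x) ≤ √T.toReal := by
      refine Real.iSup_le (fun a => ?_) (Real.sqrt_nonneg _)
      refine Real.abs_le_sqrt ?_
      rw [← ENNReal.ofReal_le_iff_le_toReal htop]
      exact ENNReal.le_tsum a
    calc _ ≤ √T.toReal ^ 2 := pow_le_pow_left₀ (maxDeviation_nonneg P _ b) hZ 2
      _ = _ := Real.sq_sqrt ENNReal.toReal_nonneg
  have hl : ENNReal.ofReal (∫ x, maxDeviation P b G (sample n x) ^ 2 ∂P) ≤ ENNReal.ofReal B := by
    rw [ofReal_integral_eq_lintegral_ofReal hZ2i (ae_of_all _ fun x => sq_nonneg _)]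
    refine (lintegral_mono hpt).trans ?_
    rw [lintegral_tsum fun a => ((measurable_deviation b a).pow_const 2).ennreal_ofReal.aemeasurable]
    rw [ENNReal.tsum_eq_iSup_sum]
    refine iSup_le fun s => ?_
    have h := sum_integral_sq_deviation_le (n := n) hP hcond hΓ hp b s
    refine le_trans (le_of_eq ?_) (ENNReal.ofReal_le_ofReal h)
    rw [ENNReal.ofReal_sum_of_nonneg fun a _ => integral_nonneg fun x => sq_nonneg _]
    exact Finset.sum_congr rfl fun a _ =>
      (ofReal_integral_eq_lintegral_ofReal (hdi a) (ae_of_all _ fun x => sq_nonneg _)).symm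
  rw [ENNReal.ofReal_le_ofReal_iff hB0] at hl
  have hvar : (∫ x, maxDeviation P b G (sample n x) ∂P) ^ 2
      ≤ ∫ x, maxDeviation P b G (sample n x) ^ 2 ∂P := by
    have h := variance_nonneg (fun x => maxDeviation P b G (sample n x)) P
    rw [variance_eq_sub ((memLp_two_iff_integrable_sq hZm.aestronglyMeasurable).2 hZ2i)] at h
    simpa using h
  refine abs_le_of_sq_le_sq' ?_ (by positivity) |>.2
  rw [mul_pow, Real.sq_sqrt (by positivity)]
  exact hvar.trans hl

end Deviation
end Guessing

namespace Guessing

/-! ### From deviations to the excess risk. -/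

section Risk

variable {A : Type*} [MeasurableSpace A] {n : ℕ} {D G : Finset ℤ}

theorem bddAbove_joint (P : Measure (ℤ → A)) [IsProbabilityMeasure P] (b : D → A) :
    BddAbove (Set.range fun a : G → A => joint P b a) :=
  ⟨1, by rintro _ ⟨a, rfl⟩; exact joint_le_one P b a⟩

theorem bddBelow_joint (P : Measure (ℤ → A)) (b : D → A) :
    BddBelow (Set.range fun a : G → A => joint P b a) :=
  ⟨0, by rintro _ ⟨a, rfl⟩; exact joint_nonneg P b a⟩

theorem iInf_const_sub_eq {ι : Type*} [Nonempty ι] {u : ι → ℝ} (hu : BddAbove (Set.range u))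
    (r : ℝ) : ⨅ i, (r - u i) = r - ⨆ i, u i := by
  have hb : BddBelow (Set.range fun i => r - u i) := by
    obtain ⟨C, hC⟩ := hu
    refine ⟨r - C, ?_⟩
    rintro _ ⟨i, rfl⟩
    exact sub_le_sub_left (hC ⟨i, rfl⟩) r
  refine le_antisymm ?_ (le_ciInf fun i => sub_le_sub_left (le_ciSup hu i) r)
  have : ⨆ i, u i ≤ r - ⨅ i, (r - u i) := ciSup_le fun i => by
    have := ciInf_le hb i
    linarith
  linarith

theorem nonempty_of_isProbabilityMeasure (P : Measure (ℤ → A)) [IsProbabilityMeasure P] :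
    Nonempty A :=
  P.nonempty_of_neZero.map fun x => x 0

theorem margin_nonneg (P : Measure (ℤ → A)) (D G : Finset ℤ) : 0 ≤ margin P D G :=
  Real.iInf_nonneg fun _ => Real.sInf_nonneg fun _ hr => hr.1.le

section

variable {P : Measure (ℤ → A)} [IsProbabilityMeasure P]
  {f : (Finset.Icc (1 : ℤ) n → A) → (D → A) → (G → A)}

theorem iSup_joint_sub_nonneg (b : D → A) (c : G → A) :
    0 ≤ (⨆ a : G → A, joint P b a) - joint P b c :=
  sub_nonneg.2 (le_ciSup (bddAbove_joint P b) c)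

theorem iSup_joint_sub_le_one (b : D → A) (c : G → A) :
    (⨆ a : G → A, joint P b a) - joint P b c ≤ 1 := by
  have h := Real.iSup_le (f := fun a : G → A => joint P b a) (fun a => joint_le_one P b a)
    zero_le_one
  linarith [joint_nonneg P b c]

/-- The count of the prediction is at least that of any a; replacing both counts by their means
costs one deviation each. -/
theorem windows_mul_gap_le (hn : 1 ≤ n) (hf : IsArgmaxEstimator n D G f)
    (y : Finset.Icc (1 : ℤ) n → A) (b : D → A) :
    windows n D G * ((⨆ a : G → A, joint P b a) - joint P b (f y b))
      ≤ 2 * maxDeviation P b G y := by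
  have := nonempty_of_isProbabilityMeasure P
  have hn' : (0 : ℝ) < n := by exact_mod_cast hn
  rw [mul_sub, Real.mul_iSup_of_nonneg (Nat.cast_nonneg _), sub_le_iff_le_add]
  refine ciSup_le fun a => ?_
  have h1 := (div_le_div_iff_of_pos_right hn').1 (hf y b a)
  have h2 := abs_le.1 (abs_deviation_le_maxDeviation P y b a)
  have h3 := abs_le.1 (abs_deviation_le_maxDeviation P y b (f y b))
  linarith

end

variable [Countable A] [DiscreteMeasurableSpace A]

theorem real_ne_and_eq (P : Measure (ℤ → A)) [IsProbabilityMeasure P] (b : D → A) (c : G → A) :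
    P.real {x | restr G x ≠ c ∧ restr D x = b} = P.real {x | restr D x = b} - joint P b c := by
  have h := measureReal_sdiff (μ := P) (s₁ := {x | restr D x = b})
    (s₂ := {y | restr G y = c ∧ restr D y = b}) (fun x hx => hx.2) (measurableSet_joint b c)
  rw [joint, ← h]
  congr 1
  ext x
  simp only [Set.mem_ofPred_eq, Set.mem_sdiff]
  tauto

/-- In the margin the probability of b cancels, leaving the gaps; a positive gap is a member of the
set whose infimum is taken, so the default value for the empty set does no harm. -/
theorem margin_le_iSup_joint_sub (P : Measure (ℤ → A)) [IsProbabilityMeasure P] (b : D → A)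
    (c : G → A) (hc : joint P b c < ⨆ a : G → A, joint P b a) :
    margin P D G ≤ (⨆ a : G → A, joint P b a) - joint P b c := by
  have := nonempty_of_isProbabilityMeasure P
  have h1 : margin P D G ≤ marginAt P D G b :=
    ciInf_le ⟨0, by rintro _ ⟨b, rfl⟩; exact Real.sInf_nonneg fun _ hr => hr.1.le⟩ b
  refine h1.trans (csInf_le ⟨0, fun r hr => hr.1.le⟩ ⟨sub_pos.2 hc, c, ?_⟩)
  simp only [real_ne_and_eq]
  rw [iInf_const_sub_eq (bddAbove_joint P b)]
  ring

/-- Fubini: with X fixed, `g` is a constant prediction, and Y contributes its joint probability. -/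
theorem prod_real_eq_and_ne (P : Measure (ℤ → A)) [IsProbabilityMeasure P] (b : D → A)
    {g : (ℤ → A) → (G → A)} (hg : Measurable g) :
    (P.prod P).real {ω | restr D ω.2 = b ∧ g ω.1 ≠ restr G ω.2}
      = P.real {x | restr D x = b} - ∫ x, joint P b (g x) ∂P := by
  have hD : MeasurableSet {ω : (ℤ → A) × (ℤ → A) | restr D ω.2 = b} :=
    ((measurable_restr D).comp measurable_snd) (measurableSet_singleton b)
  have hE : MeasurableSet {ω : (ℤ → A) × (ℤ → A) | restr G ω.2 = g ω.1 ∧ restr D ω.2 = b} :=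
    (measurableSet_eq_fun ((measurable_restr G).comp measurable_snd)
      (hg.comp measurable_fst)).inter hD
  have h := measureReal_sdiff (μ := P.prod P) (s₁ := {ω | restr D ω.2 = b})
    (s₂ := {ω | restr G ω.2 = g ω.1 ∧ restr D ω.2 = b}) (fun x hx => hx.2) hE
  have h1 : (P.prod P).real {ω | restr G ω.2 = g ω.1 ∧ restr D ω.2 = b}
      = ∫ x, joint P b (g x) ∂P := by
    rw [measureReal_def, Measure.prod_apply hE, ← integral_toReal
      (measurable_measure_prodMk_left hE).aemeasurable (ae_of_all _ fun x => measure_lt_top _ _)]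
    rfl
  have h2 : (P.prod P).real {ω | restr D ω.2 = b} = P.real {x | restr D x = b} := by
    have : {ω : (ℤ → A) × (ℤ → A) | restr D ω.2 = b} = Set.univ ×ˢ {x | restr D x = b} := by
      ext; simp
    rw [this, measureReal_prod_prod]
    simp
  rw [← h1, ← h2, ← h]
  congr 1
  ext ω
  simp only [Set.mem_ofPred_eq, Set.mem_sdiff, ne_eq, eq_comm (a := g ω.1)]
  tauto

/-- The contribution of `b` to the excess risk is the expected gap between the most likely
continuation of `b` and the predicted one. -/
theorem risk_term_eq (P : Measure (ℤ → A)) [IsProbabilityMeasure P]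
    (f : (Finset.Icc (1 : ℤ) n → A) → (D → A) → (G → A)) (b : D → A) :
    (((P.prod P)[|{ω | restr D ω.2 = b}]).real
          {ω | f (sample n ω.1) (restr D ω.2) ≠ restr G ω.2}
      - ⨅ a : G → A,
          ((P.prod P)[|{ω | restr D ω.2 = b}]).real {ω | a ≠ restr G ω.2})
    * (P.prod P).real {ω | restr D ω.2 = b}
    = ∫ x, ((⨆ a : G → A, joint P b a) - joint P b (f (sample n x) b)) ∂P := by
  have := nonempty_of_isProbabilityMeasure P
  have hD : MeasurableSet {ω : (ℤ → A) × (ℤ → A) | restr D ω.2 = b} :=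
    ((measurable_restr D).comp measurable_snd) (measurableSet_singleton b)
  -- Valid also when b has probability zero: both sides then vanish.
  have hcond : ∀ t : Set ((ℤ → A) × (ℤ → A)),
      ((P.prod P)[|{ω | restr D ω.2 = b}]).real t * (P.prod P).real {ω | restr D ω.2 = b}
        = (P.prod P).real ({ω | restr D ω.2 = b} ∩ t) := fun t => by
    rw [measureReal_def, measureReal_def, measureReal_def, ← ENNReal.toReal_mul,
      cond_mul_eq_inter hD]
  have hg : Measurable fun x : ℤ → A => f (sample n x) b :=
    (measurable_of_countable fun y => f y b).comp (measurable_sample n)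
  have hgi : Integrable (fun x : ℤ → A => joint P b (f (sample n x) b)) P :=
    integrable_of_abs_le (C := 1) ((measurable_of_countable (joint P b)).comp hg) fun x => by
      rw [abs_of_nonneg (joint_nonneg _ _ _)]
      exact joint_le_one _ _ _
  rw [sub_mul, Real.iInf_mul_of_nonneg measureReal_nonneg, hcond]
  simp only [hcond]
  have h1 : {ω : (ℤ → A) × (ℤ → A) | restr D ω.2 = b} ∩
      {ω | f (sample n ω.1) (restr D ω.2) ≠ restr G ω.2}
      = {ω | restr D ω.2 = b ∧ f (sample n ω.1) b ≠ restr G ω.2} := by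
    ext ω
    simp only [Set.mem_inter_iff, Set.mem_ofPred_eq]
    exact and_congr_right fun h => by rw [h]
  have h2 : ∀ a : G → A, (P.prod P).real ({ω : (ℤ → A) × (ℤ → A) | restr D ω.2 = b} ∩
      {ω | a ≠ restr G ω.2}) = P.real {x | restr D x = b} - joint P b a := fun a => by
    have h := prod_real_eq_and_ne P b (g := fun _ => a) measurable_const
    rw [integral_const, probReal_univ, one_smul] at h
    exact h
  rw [h1, prod_real_eq_and_ne P b hg]
  simp only [h2]
  rw [iInf_const_sub_eq (bddAbove_joint P b), integral_sub (integrable_const _) hgi]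
  simp

variable {P : Measure (ℤ → A)} {f : (Finset.Icc (1 : ℤ) n → A) → (D → A) → (G → A)}

theorem measurable_joint_estimator (b : D → A) :
    Measurable fun x : ℤ → A => joint P b (f (sample n x) b) :=
  (measurable_of_countable fun y => joint P b (f y b)).comp (measurable_sample n)

variable [IsProbabilityMeasure P]

theorem risk_le_of_forall {r : ℝ}
    (h : ∀ b : D → A, ∫ x, ((⨆ a : G → A, joint P b a) - joint P b (f (sample n x) b)) ∂P ≤ r) :
    risk P n D G f ≤ r := by
  have := nonempty_of_isProbabilityMeasure P
  refine ciSup_le fun b => ?_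
  rw [risk_term_eq]
  exact h b

theorem integrable_gap (b : D → A) :
    Integrable (fun x => (⨆ a : G → A, joint P b a) - joint P b (f (sample n x) b)) P :=
  integrable_of_abs_le (C := 1) ((measurable_joint_estimator b).const_sub _) fun x => by
    rw [abs_of_nonneg (iSup_joint_sub_nonneg b _)]
    exact iSup_joint_sub_le_one b _

theorem risk_le_beta : risk P n D G f ≤ beta P D G := by
  refine risk_le_of_forall fun b => ?_
  have h1 : ∫ x, ((⨆ a : G → A, joint P b a) - joint P b (f (sample n x) b)) ∂P
      ≤ ∫ _x, ((⨆ a : G → A, joint P b a) - ⨅ c : G → A, joint P b c) ∂P :=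
    integral_mono (integrable_gap b) (integrable_const _) fun x =>
      sub_le_sub_left (ciInf_le (bddBelow_joint P b) _) _
  refine h1.trans ?_
  rw [integral_const, probReal_univ, one_smul]
  refine le_ciSup (f := fun b : D → A =>
    (⨆ a : G → A, joint P b a) - ⨅ c : G → A, joint P b c) ⟨1, ?_⟩ b
  rintro _ ⟨b, rfl⟩
  have h2 := Real.iSup_le (f := fun a : G → A => joint P b a) (fun a => joint_le_one P b a)
    zero_le_one
  have h3 := Real.iInf_nonneg (f := fun a : G → A => joint P b a) fun a => joint_nonneg P b a
  simp only
  linarith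

variable {p : Kernel (Set.Iio (0 : ℤ) → A) A} [IsMarkovKernel p] {Γ : ℝ}

/-- The risk is of order at most `1 / √n`. -/
theorem risk_le_sqrt (hn : 1 ≤ n) (hP : IsStationary P) (hcond : IsLeftConditional P p)
    (hΓ : 0 < Γ) (hp : Γ ≤ Gam p) (hf : IsArgmaxEstimator n D G f)
    (hm : (0 : ℝ) < windows n D G) :
    risk P n D G f ≤ 2 / windows n D G * (√(n + 1) * (2 * (G.card + D.card) / Γ)) := by
  refine risk_le_of_forall fun b => ?_
  have hZi : Integrable (fun x => maxDeviation P b G (sample n x)) P :=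
    integrable_of_abs_le ((measurable_of_countable (maxDeviation (n := n) P b G)).comp
      (measurable_sample n)) fun x => abs_maxDeviation_le P _ b
  have h1 : ∫ x, ((⨆ a : G → A, joint P b a) - joint P b (f (sample n x) b)) ∂P
      ≤ ∫ x, 2 / windows n D G * maxDeviation P b G (sample n x) ∂P := by
    refine integral_mono (integrable_gap b) (hZi.const_mul _) fun x => ?_
    have h := windows_mul_gap_le (P := P) hn hf (sample n x) b
    simp only
    rw [div_mul_eq_mul_div, le_div_iff₀ hm, mul_comm]
    exact h
  rw [integral_const_mul] at h1
  exact h1.trans (mul_le_mul_of_nonneg_left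
    (integral_maxDeviation_le hP hcond hΓ hp b) (by positivity))

/-- If the margin dominates the mean deviation, then the risk is exponentially small. -/
theorem risk_le_exp (hn : 1 ≤ n) (hP : IsStationary P) (hcond : IsLeftConditional P p)
    (hΓ : 0 < Γ) (hp : Γ ≤ Gam p) (hf : IsArgmaxEstimator n D G f)
    (hm : (n + 1) * margin P D G + 4 * (√(n + 1) * (2 * (G.card + D.card) / Γ))
      ≤ 2 * windows n D G * margin P D G) :
    risk P n D G f ≤ Real.exp (-(Γ ^ 2 * n * margin P D G ^ 2)
      / (8 * ((G.card : ℝ) + D.card) ^ 2)) := by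
  refine risk_le_of_forall fun b => ?_
  have hδ := margin_nonneg P D G
  set δ := margin P D G
  set E := ∫ x, maxDeviation P b G (sample n x) ∂P
  have hEle : E ≤ √(n + 1) * (2 * (G.card + D.card) / Γ) :=
    integral_maxDeviation_le hP hcond hΓ hp b
  -- A nonzero gap is at least δ and forces Z ≥ mδ/2, that is, a deviation of Z from its mean by at
  -- least ε.
  set ε := windows n D G * δ / 2 - E with hε
  have hε4 : (n + 1) * δ ≤ 4 * ε := by rw [hε]; linarith
  have hε0 : 0 ≤ ε := by
    have : 0 ≤ (n + 1) * δ := by positivity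
    linarith
  have htail := (hasSubgaussianMGF_maxDeviation (n := n) (G := G) hP hcond hΓ hp b).measure_ge_le
    hε0
  set S := {x : ℤ → A | ε ≤ maxDeviation P b G (sample n x) - E}
  have hSm : MeasurableSet S := measurableSet_le measurable_const
    (((measurable_of_countable (maxDeviation (n := n) P b G)).comp
      (measurable_sample n)).sub_const E)
  have hrisk : ∫ x, ((⨆ a : G → A, joint P b a) - joint P b (f (sample n x) b)) ∂P ≤ P.real S := by
    have h1 : ∫ x, ((⨆ a : G → A, joint P b a) - joint P b (f (sample n x) b)) ∂P
        ≤ ∫ x, S.indicator (fun _ => (1 : ℝ)) x ∂P := by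
      refine integral_mono (integrable_gap b) ((integrable_const 1).indicator hSm) fun x => ?_
      by_cases hx : x ∈ S
      · rw [Set.indicator_of_mem hx]
        exact iSup_joint_sub_le_one b _
      · rw [Set.indicator_of_notMem hx]
        simp only [sub_nonpos]
        by_contra hlt
        refine hx ?_
        have h2 := margin_le_iSup_joint_sub P b _ (not_le.1 hlt)
        have h3 := windows_mul_gap_le (P := P) hn hf (sample n x) b
        have h4 := mul_le_mul_of_nonneg_left h2 (Nat.cast_nonneg (α := ℝ) (windows n D G))
        change ε ≤ maxDeviation P b G (sample n x) - E
        rw [hε]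
        linarith
    rwa [integral_indicator_const _ hSm, smul_eq_mul, mul_one] at h1
  refine hrisk.trans ?_
  -- For D = G = ∅ division by zero makes the exponent 0 and the bound 1.
  rcases Nat.eq_zero_or_pos (G.card + D.card) with hL | hL
  · have : (G.card : ℝ) + D.card = 0 := by exact_mod_cast hL
    rw [this]
    simp
  refine htail.trans (Real.exp_le_exp.2 ?_)
  push_cast
  rw [Real.coe_toNNReal _ hΓ.le, neg_div, neg_div, neg_le_neg_iff, one_mul]
  have hL' : (0 : ℝ) < (G.card : ℝ) + D.card := by exact_mod_cast hL
  set L := (G.card : ℝ) + D.card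
  -- One factor n + 1 cancels against the variance proxy; lowering the other to n gives the stated
  -- exponent.
  have hsq : n * (n + 1) * δ ^ 2 ≤ 16 * ε ^ 2 := by
    have h1 : ((n + 1) * δ) ^ 2 ≤ (4 * ε) ^ 2 := pow_le_pow_left₀ (by positivity) hε4 2
    nlinarith [mul_nonneg (Nat.cast_nonneg (α := ℝ) n) (sq_nonneg δ), sq_nonneg δ]
  rw [show 2 * ((n + 1) * (L / Γ) ^ 2 / 4) = (n + 1) * L ^ 2 / (2 * Γ ^ 2) by field_simp; ring,
    div_div_eq_mul_div, div_le_div_iff₀ (by positivity) (by positivity)]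
  have := mul_le_mul_of_nonneg_left hsq (by positivity : 0 ≤ Γ ^ 2 * L ^ 2)
  linarith

end Risk

/-! ### Asymptotics in n. -/

theorem eventually_le_sqrt_log (C : ℝ) : ∀ᶠ n : ℕ in atTop, C ≤ √(Real.log n) :=
  (Real.tendsto_sqrt_atTop.comp
    (Real.tendsto_log_atTop.comp tendsto_natCast_atTop_atTop)).eventually_ge_atTop C

theorem sqrt_add_one_le {n : ℕ} (hn : 1 ≤ n) : √((n : ℝ) + 1) ≤ 2 * √n := by
  have hn' : (1 : ℝ) ≤ n := by exact_mod_cast hn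
  rw [show (2 : ℝ) = √4 by rw [show (4 : ℝ) = 2 ^ 2 by norm_num]; simp,
    ← Real.sqrt_mul (by norm_num)]
  exact Real.sqrt_le_sqrt (by linarith)

end Guessing

theorem mainTheorem3 {A : Type*} [Countable A] [MeasurableSpace A] [DiscreteMeasurableSpace A]
    (D G : Finset ℤ)
    (P : ℕ → Measure (ℤ → A)) [∀ n, IsProbabilityMeasure (P n)]
    (hP : ∀ n, 1 ≤ n → Guessing.IsStationary (P n))
    (p : ℕ → Kernel (Set.Iio (0 : ℤ) → A) A) [∀ n, IsMarkovKernel (p n)]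
    (hp : ∀ n, 1 ≤ n → Guessing.IsLeftConditional (P n) (p n))
    (Γ : ℝ) (hΓ : 0 < Γ) (hpΓ : ∀ n, 2 ≤ n → Γ ≤ Guessing.Gam (p n))
    (f : (n : ℕ) → (Finset.Icc (1 : ℤ) n → A) → (D → A) → (G → A))
    (hf : ∀ n, 1 ≤ n → Guessing.IsArgmaxEstimator n D G (f n)) :
    (Tendsto (fun n : ℕ => Guessing.margin (P n) D G * √((n : ℝ) / Real.log n)) atTop (𝓝 0) →
      ∃ n₀ : ℕ, 2 ≤ n₀ ∧ ∀ n, n₀ ≤ n →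
        Guessing.risk (P n) n D G (f n) ≤
          min (1 / 2 * √(Real.log n / (n : ℝ))) (Guessing.beta (P n) D G)) ∧
    (Tendsto (fun n : ℕ => Guessing.margin (P n) D G * √((n : ℝ) / Real.log n)) atTop atTop →
      ∃ n₀ : ℕ, 1 ≤ n₀ ∧ ∀ n, n₀ ≤ n →
        Guessing.risk (P n) n D G (f n) ≤
          min (Real.exp (-(Γ ^ 2 * n * Guessing.margin (P n) D G ^ 2)
                / (8 * ((G.card : ℝ) + D.card) ^ 2)))
            (Guessing.beta (P n) D G)) := by
  obtain ⟨M, hM⟩ := Guessing.windows_ge D G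
  -- Chosen so that E Z ≤ C√n, using √(n + 1) ≤ 2√n.
  set C : ℝ := 4 * (G.card + D.card) / Γ with hC
  have hC0 : 0 ≤ C := by positivity
  have hmean : ∀ n : ℕ, 1 ≤ n → √((n : ℝ) + 1) * (2 * (G.card + D.card) / Γ) ≤ C * √n := by
    intro n hn
    have h := mul_le_mul_of_nonneg_right (Guessing.sqrt_add_one_le hn)
      (by positivity : 0 ≤ 2 * ((G.card : ℝ) + D.card) / Γ)
    refine h.trans_eq ?_
    rw [hC]
    ring
  obtain ⟨N, hN⟩ := eventually_atTop.1 (Guessing.eventually_le_sqrt_log (8 * C))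
  constructor
  · intro _
    -- For such n, m ≥ n - M ≥ n/2, so the risk is at most 4C/√n, and 8C ≤ √(log n) concludes.
    refine ⟨N + 4 * M + 2, by omega, fun n hn => le_min ?_ Guessing.risk_le_beta⟩
    have hn1 : 1 ≤ n := by omega
    have hlog := hN n (by omega)
    have hnM : (4 * M + 2 : ℝ) ≤ n := by exact_mod_cast (by omega : 4 * M + 2 ≤ n)
    have hn0 : (0 : ℝ) < n := by exact_mod_cast hn1
    have hw : (n : ℝ) / 2 ≤ Guessing.windows n D G := by linarith [hM n]
    have hw0 : (0 : ℝ) < Guessing.windows n D G := by linarith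
    refine (Guessing.risk_le_sqrt hn1 (hP n hn1) (hp n hn1) hΓ (hpΓ n (by omega)) (hf n hn1)
      hw0).trans ?_
    have hs0 : 0 < √(n : ℝ) := Real.sqrt_pos.2 hn0
    have hss : √(n : ℝ) * √n = n := Real.mul_self_sqrt hn0.le
    calc 2 / Guessing.windows n D G * (√((n : ℝ) + 1) * (2 * (G.card + D.card) / Γ))
        ≤ 2 / (n / 2) * (C * √n) := by
          refine mul_le_mul (div_le_div_of_nonneg_left (by norm_num) (by positivity) hw)
            (hmean n hn1) (by positivity) (by positivity)
      _ = 1 / 2 * (8 * C / √n) := by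
          nth_rewrite 1 [← hss]
          field_simp
          ring
      _ ≤ 1 / 2 * √(Real.log n / n) := by
          rw [Real.sqrt_div' _ hn0.le]
          gcongr
  · intro hδ
    obtain ⟨N', hN'⟩ := eventually_atTop.1 (hδ.eventually_ge_atTop 1)
    -- With 4C√n ≤ nδ/2 and m ≥ n - M, the condition of `risk_le_exp` reduces to (2M + 1)δ ≤ nδ/2.
    refine ⟨N + N' + 4 * M + 2, by omega, fun n hn => le_min ?_ Guessing.risk_le_beta⟩
    have hn1 : 1 ≤ n := by omega
    have hlog := hN n (by omega)
    have hδn := hN' n (by omega)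
    have hnM : (4 * M + 2 : ℝ) ≤ n := by exact_mod_cast (by omega : 4 * M + 2 ≤ n)
    have hn0 : (0 : ℝ) < n := by exact_mod_cast hn1
    refine Guessing.risk_le_exp hn1 (hP n hn1) (hp n hn1) hΓ (hpΓ n (by omega)) (hf n hn1) ?_
    have hδ0 := Guessing.margin_nonneg (P n) D G
    set δ := Guessing.margin (P n) D G
    have hs0 : 0 < √(n : ℝ) := Real.sqrt_pos.2 hn0
    have hss : √(n : ℝ) * √n = n := Real.mul_self_sqrt hn0.le
    -- If √(log n) vanished, division by zero would give 0, against the lower bound 1.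
    have hlog0 : 0 < √(Real.log n) := by
      rw [Real.sqrt_div hn0.le] at hδn
      refine lt_of_le_of_ne (Real.sqrt_nonneg _) fun h => ?_
      rw [← h, div_zero, mul_zero] at hδn
      linarith
    rw [Real.sqrt_div hn0.le, ← mul_div_assoc, le_div_iff₀ hlog0, one_mul] at hδn
    have hbig : 8 * C * √n ≤ n * δ := by
      calc 8 * C * √n ≤ (δ * √n) * √n := mul_le_mul_of_nonneg_right (hlog.trans hδn) hs0.le
        _ = n * δ := by rw [mul_assoc, hss, mul_comm]
    have hwδ := mul_le_mul_of_nonneg_right (hM n) hδ0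
    have hMδ := mul_le_mul_of_nonneg_right hnM hδ0
    have := hmean n hn1
    linarith
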